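/- Let $c\in\mathbb R$ and let $\mathbb H_c=L^2(\mathbb R,e^{-2ct}\,dt)$ (complex-valued functions). Let $\partial_c f=f'$ be the operator on $\mathbb H_c$ whose domain consists of the locally absolutely continuous $f\in\mathbb H_c$ with $f'\in\mathbb H_c$, and let $V_c=(\partial_c-c)/i$, an unbounded self-adjoint operator. Let $T>0$ and let $\varphi:\mathbb R\to\mathbb R$ be a $T$-admissible cut-off function: $\varphi$ is continuous, the closure of its range is $[-T,T]$, and, in the case $c=1$, $\varphi$ is moreover the restriction to $\mathbb R$ of a function meromorphic in an open neighbourhood of $\mathbb R$ in $\mathbb C$. Define, by the measurable functional calculus for (possibly unbounded) normal operators, $\partial_c^{(T)}=c+i\varphi(V_c)$ and the truncated spectral operator $\mathfrak a_c^{(T)}=\zeta(\partial_c^{(T)})$, where $\zeta$ is the Riemann zeta function. Then: 1. $\mathfrak a_c^{(T)}$ is normal (closed, densely defined, and commuting with its adjoint). 2. If $c\neq 1$, then $\mathfrak a_c^{(T)}$ is a bounded operator defined on all of $\mathbb H_c$, and its spectrum is $\sigma(\mathfrak a_c^{(T)})=\{\zeta(c+i\tau):\tau\in\mathbb R,\ |\tau|\le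 T\}$. 3. If $c=1$, then $\mathfrak a_c^{(T)}$ is unbounded, and its extended spectrum $\tilde\sigma(\mathfrak a_c^{(T)})=\sigma(\mathfrak a_c^{(T)})\cup\{\infty\}$, a subset of the Riemann sphere $\mathbb C\cup\{\infty\}$, equals $\{\zeta(c+i\tau):\tau\in\mathbb R,\ |\tau|\le T\}$, where $\zeta$ is regarded as a function with values in the Riemann sphere, $\zeta(1)=\infty$. 4. $\mathfrak a_c^{(T)}$ is invertible (it has a bounded, everywhere defined two-sided inverse) if and only if $\zeta$ has no zero on the segment $\{s\in\mathbb C:\operatorname{Re}s=c,\ |\operatorname{Im}s|\le T\}$. -/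

import Mathlib

open MeasureTheory Set Filter Topology

noncomputable section

namespace SpectralOperator

/-! ### Possibly unbounded operators on a Hilbert space -/

section Operators

variable {H : Type*} [NormedAddCommGroup H] [InnerProductSpace ℂ H]

/-- The operator `α + β A`, with the same domain as `A`. -/
def affine (α β : ℂ) (A : H →ₗ.[ℂ] H) : H →ₗ.[ℂ] H :=
  (α • (LinearMap.id : H →ₗ[ℂ] H)) +ᵥ (β • A)

/-- `A` is invertible: there is a bounded operator `B`, defined on all of `H` and with values in
`D(A)`, such that `A B u = u` for all `u ∈ H` and `B A v = v` for all `v ∈ D(A)`. -/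
def IsInvertible (A : H →ₗ.[ℂ] H) : Prop :=
  ∃ B : H →L[ℂ] H,
    (∀ u : H, ∃ h : B u ∈ A.domain, A ⟨B u, h⟩ = u) ∧ ∀ v : A.domain, B (A v) = v

/-- The spectrum of a possibly unbounded operator: all `z` for which `A - z` is not invertible. -/
def spectrum (A : H →ₗ.[ℂ] H) : Set ℂ :=
  {z | ¬ IsInvertible (affine (-z) 1 A)}

/-- `A` is bounded on its domain. -/
def IsBounded (A : H →ₗ.[ℂ] H) : Prop :=
  ∃ C : ℝ, ∀ x : A.domain, ‖A x‖ ≤ C * ‖(x : H)‖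

/-- The extended spectrum, a subset of the Riemann sphere: the spectrum, together with `∞` when
`A` is unbounded. -/
def extendedSpectrum (A : H →ₗ.[ℂ] H) : Set (OnePoint ℂ) :=
  ((↑) : ℂ → OnePoint ℂ) '' spectrum A ∪ {z | z = OnePoint.infty ∧ ¬ IsBounded A}

/-- `A` is normal: closed, densely defined, and `A* A = A A*` as partially defined operators
(equal graphs, hence equal domains). -/
def IsNormal [CompleteSpace H] (A : H →ₗ.[ℂ] H) : Prop :=
  A.IsClosed ∧ Dense (A.domain : Set H) ∧
    ∀ x z : H, (∃ y, (x, y) ∈ A.graph ∧ (y, z) ∈ A.adjoint.graph) ↔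
      (∃ y, (x, y) ∈ A.adjoint.graph ∧ (y, z) ∈ A.graph)

end Operators

/-! ### Resolutions of the identity and the measurable functional calculus -/

/-- A resolution of the identity (projection-valued measure) on the Borel sets of `ℂ`. The values
on sets that are not Borel are irrelevant. -/
structure ResolutionOfIdentity (H : Type*) [NormedAddCommGroup H] [InnerProductSpace ℂ H]
    [CompleteSpace H] where
  proj : Set ℂ → H →L[ℂ] H
  isStarProjection : ∀ s, MeasurableSet s → IsStarProjection (proj s)
  proj_univ : proj univ = 1
  proj_inter : ∀ s t, MeasurableSet s → MeasurableSet t → proj (s ∩ t) = proj s * proj t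
  hasSum_proj : ∀ s : ℕ → Set ℂ, (∀ n, MeasurableSet (s n)) → Pairwise (Function.onFun Disjoint s) →
    ∀ x : H, HasSum (fun n => proj (s n) x) (proj (⋃ n, s n) x)

section Calculus

variable {H : Type*} [NormedAddCommGroup H] [InnerProductSpace ℂ H] [CompleteSpace H]

namespace ResolutionOfIdentity

variable (E : ResolutionOfIdentity H)

theorem proj_empty_apply (x : H) : E.proj ∅ x = 0 := by
  have h := E.hasSum_proj (fun _ => ∅) (fun _ => MeasurableSet.empty)
    (fun _ _ _ => by simp [Function.onFun]) x
  exact tendsto_nhds_unique tendsto_const_nhds h.summable.tendsto_atTop_zero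

theorem inner_proj {s : Set ℂ} (hs : MeasurableSet s) (x : H) :
    (inner ℂ x (E.proj s x)).re = ‖E.proj s x‖ ^ 2 := by
  have hp := E.isStarProjection s hs
  have h1 : E.proj s (E.proj s x) = E.proj s x :=
    congrArg (fun B : H →L[ℂ] H => B x) hp.isIdempotentElem
  have h2 : ContinuousLinearMap.adjoint (E.proj s) = E.proj s := hp.isSelfAdjoint
  have h3 : inner ℂ x (E.proj s x) = inner ℂ (E.proj s x) (E.proj s x) := by
    conv_lhs => rw [← h1]
    conv_rhs => arg 2; rw [← h2]
    rw [ContinuousLinearMap.adjoint_inner_left]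
  rw [h3, inner_self_eq_norm_sq_to_K]
  norm_cast

/-- The finite positive measure `E_x(s) = ⟨E(s) x, x⟩ = ‖E(s) x‖²` on `ℂ`. -/
def scalarMeasure (x : H) : Measure ℂ :=
  Measure.ofMeasurable (fun s _ => ENNReal.ofReal (‖E.proj s x‖ ^ 2))
    (by simp [E.proj_empty_apply x])
    (by
      intro s hs hd
      have h := ((E.hasSum_proj s hs hd x).mapL (innerSL ℂ x)).mapL Complex.reCLM
      simp only [innerSL_apply_apply, Complex.reCLM_apply] at h
      rw [E.inner_proj (MeasurableSet.iUnion hs)] at h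
      have h' : HasSum (fun n => ‖E.proj (s n) x‖ ^ 2) (‖E.proj (⋃ n, s n) x‖ ^ 2) := by
        simpa only [E.inner_proj (hs _)] using h
      rw [← h'.tsum_eq, ENNReal.ofReal_tsum_of_nonneg (fun n => by positivity) h'.summable])

theorem scalarMeasure_apply (x : H) {s : Set ℂ} (hs : MeasurableSet s) :
    E.scalarMeasure x s = ENNReal.ofReal (‖E.proj s x‖ ^ 2) :=
  Measure.ofMeasurable_apply s hs

/-- `A = ∫ f dE`: the domain of `A` consists of the vectors `x` with `∫ |f|² dE_x < ∞`, and
`⟨A x, x⟩ = ∫ f dE_x` for these `x`. The domain is dense, so by polarization the quadratic form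
determines `A`. Mathlib's inner product is linear in the second argument. -/
def IsIntegral (f : ℂ → ℂ) (A : H →ₗ.[ℂ] H) : Prop :=
  Measurable f ∧
  (∀ x : H, x ∈ A.domain ↔ ∫⁻ z, ‖f z‖ₑ ^ 2 ∂(E.scalarMeasure x) < ⊤) ∧
  ∀ x : A.domain, inner ℂ (x : H) (A x) = ∫ z, f z ∂(E.scalarMeasure (x : H))

end ResolutionOfIdentity

/-- `A = f(N)` in the measurable functional calculus of the normal operator `N`: for the resolution
of the identity `E` of `N`, i.e. `N = ∫ z dE(z)`, one has `A = ∫ f(z) dE(z)`. -/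
def IsFunctionOf (N : H →ₗ.[ℂ] H) (f : ℂ → ℂ) (A : H →ₗ.[ℂ] H) : Prop :=
  ∃ E : ResolutionOfIdentity H, E.IsIntegral id N ∧ E.IsIntegral f A

open Classical in
/-- The operator `f(N)` given by the measurable functional calculus of a normal operator `N`. When
`N` has no resolution of the identity (it is not normal), or `f` is not measurable, the value is
the operator with domain `{0}`. -/
def functionalCalculus (f : ℂ → ℂ) (N : H →ₗ.[ℂ] H) : H →ₗ.[ℂ] H :=
  if h : ∃ A, IsFunctionOf N f A then h.choose else ⊥

end Calculus

/-! ### The weighted space, the infinitesimal shift and its truncations -/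

/-- The measure `e^{-2ct} dt` on `ℝ`. -/
def weightMeasure (c : ℝ) : Measure ℝ :=
  volume.withDensity (fun t => ENNReal.ofReal (Real.exp (-2 * c * t)))

/-- The Hilbert space `L²(ℝ, e^{-2ct} dt)` of complex-valued functions. -/
abbrev WeightedSpace (c : ℝ) : Type := Lp ℂ 2 (weightMeasure c)

/-- Local absolute continuity on `ℝ`. -/
def LocallyAC (g : ℝ → ℂ) : Prop := ∀ a b : ℝ, AbsolutelyContinuousOnInterval g a b

/-- The graph of the infinitesimal shift: pairs `(f, h)` in the weighted space such that `f` has a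
locally absolutely continuous representative whose derivative is `h` almost everywhere. -/
def shiftGraph (c : ℝ) : Submodule ℂ (WeightedSpace c × WeightedSpace c) where
  carrier := {p | ∃ g : ℝ → ℂ, LocallyAC g ∧ p.1 =ᵐ[weightMeasure c] g ∧
    ∀ᵐ t ∂(weightMeasure c), HasDerivAt g (p.2 t) t}
  add_mem' := by
    rintro p q ⟨g, hg, hpg, hg'⟩ ⟨k, hk, hqk, hk'⟩
    refine ⟨g + k, fun a b => (hg a b).add (hk a b), ?_, ?_⟩
    · exact (Lp.coeFn_add p.1 q.1).trans (hpg.add hqk)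
    · filter_upwards [hg', hk', Lp.coeFn_add p.2 q.2] with t h1 h2 h3
      have h4 : (p + q).2 t = p.2 t + q.2 t := h3
      rw [h4]
      exact h1.add h2
  zero_mem' := by
    refine ⟨0, fun a b => ?_, Lp.coeFn_zero _ _ _, ?_⟩
    · have h : LipschitzOnWith 0 (0 : ℝ → ℂ) (uIcc a b) := fun x _ y _ => by simp
      exact h.absolutelyContinuousOnInterval
    · filter_upwards [Lp.coeFn_zero ℂ 2 (weightMeasure c)] with t h
      have h4 : (0 : WeightedSpace c × WeightedSpace c).2 t = 0 := h
      rw [h4]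
      exact hasDerivAt_const t 0
  smul_mem' := by
    rintro z p ⟨g, hg, hpg, hg'⟩
    refine ⟨z • g, fun a b => (hg a b).const_smul z, ?_, ?_⟩
    · exact (Lp.coeFn_smul z p.1).trans (hpg.const_smul z)
    · filter_upwards [hg', Lp.coeFn_smul z p.2] with t h1 h3
      have h4 : (z • p).2 t = z • p.2 t := h3
      rw [h4]
      exact h1.const_smul z

/-- The infinitesimal shift `∂_c f = f'` on `L²(ℝ, e^{-2ct} dt)`, with domain all locally absolutely
continuous `f` in the space with `f'` in the space. -/
def shift (c : ℝ) : WeightedSpace c →ₗ.[ℂ] WeightedSpace c := (shiftGraph c).toLinearPMap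

theorem volume_absolutelyContinuous_weightMeasure (c : ℝ) :
    (volume : Measure ℝ) ≪ weightMeasure c := by
  refine withDensity_absolutelyContinuous' (by fun_prop) ?_
  exact Eventually.of_forall fun t => by simp [Real.exp_pos]

/-- The derivative is well defined, so `shift c` has the graph `shiftGraph c`. -/
theorem shift_graph (c : ℝ) : (shift c).graph = shiftGraph c := by
  refine Submodule.toLinearPMap_graph_eq _ ?_
  rintro ⟨f, h⟩ ⟨g, hg, hfg, hg'⟩ hf
  simp only at hf hfg hg'
  subst hf
  have hcont : Continuous g := by
    refine continuous_iff_continuousAt.2 fun t => ?_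
    have h1 := (hg (t - 1) (t + 1)).continuousOn
    refine h1.continuousAt ?_
    rw [uIcc_of_le (by linarith)]
    exact Icc_mem_nhds (by linarith) (by linarith)
  have hg0 : g = 0 := by
    have h1 : g =ᵐ[weightMeasure c] 0 := hfg.symm.trans (Lp.coeFn_zero _ _ _)
    exact (hcont.ae_eq_iff_eq volume continuous_zero).1
      ((volume_absolutelyContinuous_weightMeasure c).ae_le h1)
  subst hg0
  refine Lp.ext ?_
  filter_upwards [hg', Lp.coeFn_zero ℂ 2 (weightMeasure c)] with t h1 h2
  rw [h2]
  exact h1.unique (hasDerivAt_const t 0)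

/-- The `c`-momentum operator `V_c = (∂_c - c) / i`, with the domain of `∂_c`. -/
def momentum (c : ℝ) : WeightedSpace c →ₗ.[ℂ] WeightedSpace c :=
  affine (-(c : ℂ) / Complex.I) (1 / Complex.I) (shift c)

/-- A `T`-admissible cut-off function: `φ : ℝ → ℝ` is continuous and the closure of its range is
`[-T, T]`; when `c = 1`, moreover, `φ` is the restriction to `ℝ` of a function that is meromorphic
in an open neighbourhood of `ℝ` in `ℂ`. -/
def IsAdmissibleCutoff (c T : ℝ) (φ : ℝ → ℝ) : Prop :=
  Continuous φ ∧ closure (range φ) = Icc (-T) T ∧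
    (c = 1 → ∃ (U : Set ℂ) (Φ : ℂ → ℂ), IsOpen U ∧ (∀ x : ℝ, (x : ℂ) ∈ U) ∧ MeromorphicOn Φ U ∧
      ∀ x : ℝ, Φ x = φ x)

/-- `φ(V_c)`. The operator `V_c` is self-adjoint, so its resolution of the identity lives on the
real line and only the values of `z ↦ φ (Re z)` at real `z` matter. -/
def truncatedMomentum (c : ℝ) (φ : ℝ → ℝ) : WeightedSpace c →ₗ.[ℂ] WeightedSpace c :=
  functionalCalculus (fun z => (φ z.re : ℂ)) (momentum c)

/-- The truncated infinitesimal shift `c + i φ(V_c)`. -/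
def truncatedShift (c : ℝ) (φ : ℝ → ℝ) : WeightedSpace c →ₗ.[ℂ] WeightedSpace c :=
  affine c Complex.I (truncatedMomentum c φ)

/-- The truncated spectral operator `ζ(c + i φ(V_c))`. -/
def truncatedSpectralOperator (c : ℝ) (φ : ℝ → ℝ) : WeightedSpace c →ₗ.[ℂ] WeightedSpace c :=
  functionalCalculus riemannZeta (truncatedShift c φ)

open Classical in
/-- The Riemann zeta function as a function with values in the Riemann sphere, with its pole
at `1`. -/
def zetaSphere (s : ℂ) : OnePoint ℂ :=
  if s = 1 then OnePoint.infty else (riemannZeta s : OnePoint ℂ)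

end SpectralOperator

end

/-!
After the unitary map `f ↦ 𝓕 (e^{-ct} f)` onto `L²(ℝ)` the momentum operator is multiplication by
`2πξ`, which yields its resolution of the identity `E`, and `E s = 0` exactly when `s ∩ ℝ` is a
Lebesgue null set. Pushing `E` forward along `c + iφ` gives the resolution of the identity `F` of
`c + iφ(V_c)`, whose support is the segment `[c - iT, c + iT]` because `φ` is continuous with
range dense in `[-T, T]`. Hence `ζ(c + iφ(V_c))` is the integral of `ζ` against `F`; as for
multiplication operators, its extended spectrum is the `F`-essential range of `ζ` in the Riemann
sphere. For `c = 1` the pole is `F`-null, since a meromorphic `φ ≢ 0` vanishes only on a null set,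
so `ζ` may be replaced by the continuous map `zetaSphere`; its essential range is the image of the
compact support. All assertions on boundedness, spectrum and invertibility are read off from this
image.

The spectral theorem itself is not needed, only the uniqueness of `E`: the projection
`E (closedBall a r)` has as range the vectors `x` with `‖(N - a)^n x‖ ≤ r^n ‖x‖` for all `n`, so
that `N` determines `E`.
-/

namespace SpectralOperator

/-! ### Integrating simple functions against a resolution of the identity -/

theorem eLpNorm_two_sq {α F : Type*} [MeasurableSpace α] [NormedAddCommGroup F] (f : α → F)
    (μ : Measure α) : eLpNorm f 2 μ ^ 2 = ∫⁻ z, ‖f z‖ₑ ^ 2 ∂μ := by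
  simpa using eLpNorm_nnreal_pow_eq_lintegral (f := f) (μ := μ) (p := 2) two_ne_zero

theorem memLp_two_iff {α F : Type*} [MeasurableSpace α] [NormedAddCommGroup F] {f : α → F}
    {μ : Measure α} (hf : AEStronglyMeasurable f μ) :
    MemLp f 2 μ ↔ ∫⁻ z, ‖f z‖ₑ ^ 2 ∂μ < ⊤ := by
  rw [← eLpNorm_two_sq, MemLp]
  simp [hf]

namespace ResolutionOfIdentity

variable {H : Type*} [NormedAddCommGroup H] [InnerProductSpace ℂ H] [CompleteSpace H]
  (E : ResolutionOfIdentity H)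

theorem proj_empty : E.proj ∅ = 0 := by
  ext x
  exact E.proj_empty_apply x

theorem scalarMeasure_apply_enorm (x : H) {s : Set ℂ} (hs : MeasurableSet s) :
    E.scalarMeasure x s = ‖E.proj s x‖ₑ ^ 2 := by
  rw [E.scalarMeasure_apply x hs, ENNReal.ofReal_pow (norm_nonneg _), ofReal_norm]

instance (x : H) : IsFiniteMeasure (E.scalarMeasure x) :=
  ⟨by rw [E.scalarMeasure_apply x MeasurableSet.univ]; exact ENNReal.ofReal_lt_top⟩

theorem inner_proj_right {s : Set ℂ} (hs : MeasurableSet s) (x y : H) :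
    inner ℂ x (E.proj s y) = inner ℂ (E.proj s x) y := by
  rw [← ContinuousLinearMap.adjoint_inner_right]
  exact congrArg (fun P : H →L[ℂ] H => inner ℂ x (P y)) (E.isStarProjection s hs).isSelfAdjoint.symm

theorem inner_proj_self {s : Set ℂ} (hs : MeasurableSet s) (x : H) :
    inner ℂ x (E.proj s x) = ((E.scalarMeasure x).real s : ℂ) := by
  have hreal : (inner ℂ x (E.proj s x)).im = 0 := by
    have hconj := inner_conj_symm (𝕜 := ℂ) x (E.proj s x)
    rw [← E.inner_proj_right hs] at hconj
    exact Complex.conj_eq_iff_im.1 hconj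
  apply Complex.ext
  · rw [E.inner_proj hs, Complex.ofReal_re, measureReal_def, E.scalarMeasure_apply x hs,
      ENNReal.toReal_ofReal (by positivity)]
  · rw [hreal, Complex.ofReal_im]

theorem proj_union {s t : Set ℂ} (hs : MeasurableSet s) (ht : MeasurableSet t)
    (hst : Disjoint s t) : E.proj (s ∪ t) = E.proj s + E.proj t := by
  have hquad : ∀ x, inner ℂ (E.proj (s ∪ t) x) x = inner ℂ ((E.proj s + E.proj t) x) x := by
    intro x
    rw [_root_.add_apply, inner_add_left, ← E.inner_proj_right (hs.union ht),
      ← E.inner_proj_right hs, ← E.inner_proj_right ht, E.inner_proj_self (hs.union ht),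
      E.inner_proj_self hs, E.inner_proj_self ht, measureReal_union hst ht, Complex.ofReal_add]
  exact ContinuousLinearMap.coe_injective ((ext_inner_map _ _).1 hquad)

/-- The map `a ↦ a E(s)`, through which simple functions are integrated. -/
noncomputable def smulProj (s : Set ℂ) : ℂ →L[ℝ] H →L[ℂ] H :=
  ((ContinuousLinearMap.id ℂ ℂ).smulRight (E.proj s)).restrictScalars ℝ

theorem smulProj_apply (s : Set ℂ) (a : ℂ) : E.smulProj s a = a • E.proj s := rfl

theorem finMeasAdditive_smulProj : FinMeasAdditive (0 : Measure ℂ) E.smulProj := by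
  intro s t hs ht _ _ hst
  ext1 a
  simp [smulProj_apply, E.proj_union hs ht hst]

/-- The bounded operator `∫ f dE` for a simple function `f`. -/
noncomputable def simpleIntegral (f : SimpleFunc ℂ ℂ) : H →L[ℂ] H := f.setToSimpleFunc E.smulProj

theorem simpleIntegral_add (f g : SimpleFunc ℂ ℂ) :
    E.simpleIntegral (f + g) = E.simpleIntegral f + E.simpleIntegral g :=
  SimpleFunc.setToSimpleFunc_add _ E.finMeasAdditive_smulProj integrable_zero_measure
    integrable_zero_measure

theorem simpleIntegral_sub (f g : SimpleFunc ℂ ℂ) :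
    E.simpleIntegral (f - g) = E.simpleIntegral f - E.simpleIntegral g :=
  SimpleFunc.setToSimpleFunc_sub _ E.finMeasAdditive_smulProj integrable_zero_measure
    integrable_zero_measure

/-- The simple function equal to `a` on `s` and to `0` elsewhere. -/
noncomputable abbrev simpleIndicator (a : ℂ) {s : Set ℂ} (hs : MeasurableSet s) : SimpleFunc ℂ ℂ :=
  SimpleFunc.piecewise s hs (SimpleFunc.const _ a) (SimpleFunc.const _ 0)

theorem simpleIntegral_simpleIndicator (a : ℂ) {s : Set ℂ} (hs : MeasurableSet s) :
    E.simpleIntegral (simpleIndicator a hs) = a • E.proj s := by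
  rw [simpleIntegral, SimpleFunc.setToSimpleFunc_indicator E.smulProj
    (by ext1 a; simp [smulProj_apply, E.proj_empty]) hs a, smulProj_apply]

theorem simpleIntegral_indicator_one {s : Set ℂ} (hs : MeasurableSet s) :
    E.simpleIntegral (simpleIndicator 1 hs) = E.proj s := by
  rw [E.simpleIntegral_simpleIndicator, one_smul]

theorem simpleIndicator_mul (a b : ℂ) {s t : Set ℂ} (hs : MeasurableSet s) (ht : MeasurableSet t) :
    simpleIndicator a hs * simpleIndicator b ht = simpleIndicator (a * b) (hs.inter ht) := by
  ext z
  by_cases hzs : z ∈ s <;> by_cases hzt : z ∈ t <;> simp [piecewise, hzs, hzt]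

theorem simpleIntegral_mul (f g : SimpleFunc ℂ ℂ) :
    E.simpleIntegral (f * g) = E.simpleIntegral f * E.simpleIntegral g := by
  induction f using SimpleFunc.induction with
  | const a hs =>
    induction g using SimpleFunc.induction with
    | const b ht =>
      rw [simpleIndicator_mul, E.simpleIntegral_simpleIndicator, E.simpleIntegral_simpleIndicator,
        E.simpleIntegral_simpleIndicator, E.proj_inter _ _ hs ht, smul_mul_smul_comm]
    | add _ hf hg => rw [mul_add, E.simpleIntegral_add, hf, hg, E.simpleIntegral_add, mul_add]
  | add _ hf hf' => rw [add_mul, E.simpleIntegral_add, hf, hf', E.simpleIntegral_add, add_mul]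

theorem inner_simpleIntegral (f : SimpleFunc ℂ ℂ) (x y : H) :
    inner ℂ x (E.simpleIntegral f y) = inner ℂ (E.simpleIntegral (f.map (starRingEnd ℂ)) x) y := by
  induction f using SimpleFunc.induction with
  | @const a s hs =>
    have hmap : (simpleIndicator a hs).map (starRingEnd ℂ) =
        simpleIndicator (starRingEnd ℂ a) hs := by
      ext z
      by_cases hz : z ∈ s <;> simp [piecewise, hz]
    rw [hmap, E.simpleIntegral_simpleIndicator, E.simpleIntegral_simpleIndicator]
    simp [E.inner_proj_right hs, mul_comm]
  | @add f g _ hf hg =>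
    have hmap : (f + g).map (starRingEnd ℂ) =
        f.map (starRingEnd ℂ) + g.map (starRingEnd ℂ) := by
      ext z
      simp
    rw [hmap, E.simpleIntegral_add, E.simpleIntegral_add, _root_.add_apply, _root_.add_apply,
      inner_add_left, inner_add_right, hf, hg]

theorem inner_simpleIntegral_self (f : SimpleFunc ℂ ℂ) (x : H) :
    inner ℂ x (E.simpleIntegral f x) = ∫ z, f z ∂(E.scalarMeasure x) := by
  induction f using SimpleFunc.induction with
  | const a hs =>
    rw [E.simpleIntegral_simpleIndicator]
    simp only [_root_.smul_apply, inner_smul_right, E.inner_proj_self hs, SimpleFunc.coe_piecewise,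
      SimpleFunc.coe_const, Function.const_zero, piecewise_eq_indicator]
    rw [integral_indicator hs]
    simp [mul_comm]
  | @add f g _ hf hg =>
    rw [E.simpleIntegral_add, _root_.add_apply, inner_add_right, hf, hg, SimpleFunc.coe_add]
    exact (integral_add f.integrable_of_isFiniteMeasure g.integrable_of_isFiniteMeasure).symm

theorem norm_simpleIntegral_sq (f : SimpleFunc ℂ ℂ) (x : H) :
    ‖E.simpleIntegral f x‖ ^ 2 = ∫ z, ‖f z‖ ^ 2 ∂(E.scalarMeasure x) := by
  apply Complex.ofReal_injective
  calc ((‖E.simpleIntegral f x‖ ^ 2 : ℝ) : ℂ)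
      = inner ℂ (E.simpleIntegral f x) (E.simpleIntegral f x) := by
        rw [inner_self_eq_norm_sq_to_K]
        push_cast
        rfl
    _ = inner ℂ x (E.simpleIntegral (f.map (starRingEnd ℂ) * f) x) := by
        have hconj : (f.map (starRingEnd ℂ)).map (starRingEnd ℂ) = f := by
          ext z
          simp
        rw [E.simpleIntegral_mul, mul_apply_eq_comp, E.inner_simpleIntegral (f.map _), hconj]
    _ = ∫ z, ((‖f z‖ ^ 2 : ℝ) : ℂ) ∂(E.scalarMeasure x) := by
        rw [E.inner_simpleIntegral_self]
        congr with z
        simp [← Complex.normSq_eq_conj_mul_self, Complex.normSq_eq_norm_sq]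
    _ = _ := integral_complex_ofReal

theorem enorm_simpleIntegral (f : SimpleFunc ℂ ℂ) (x : H) :
    ‖E.simpleIntegral f x‖ₑ = eLpNorm f 2 (E.scalarMeasure x) := by
  refine (ENNReal.pow_right_strictMono two_ne_zero).injective ?_
  have hint : Integrable (fun z => ‖f z‖ ^ 2) (E.scalarMeasure x) :=
    (f.memLp_of_isFiniteMeasure 2 _).integrable_norm_pow two_ne_zero
  rw [eLpNorm_two_sq, ← ofReal_norm, ← ENNReal.ofReal_pow (norm_nonneg _),
    E.norm_simpleIntegral_sq, ofReal_integral_eq_lintegral_ofReal hint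
      (Eventually.of_forall fun z => by positivity)]
  simp only [← ofReal_norm, ENNReal.ofReal_pow (norm_nonneg _)]

theorem edist_simpleIntegral (f g : SimpleFunc ℂ ℂ) (x : H) :
    edist (E.simpleIntegral f x) (E.simpleIntegral g x) =
      eLpNorm (⇑f - ⇑g) 2 (E.scalarMeasure x) := by
  rw [edist_eq_enorm_sub, ← _root_.sub_apply, ← E.simpleIntegral_sub, E.enorm_simpleIntegral,
    SimpleFunc.coe_sub]

/-! ### The value of `∫ f dE` at a vector -/

/-- The filter of simple functions close to `f` in `L²(μ)`. -/
noncomputable def simpleNhds (f : ℂ → ℂ) (μ : Measure ℂ) : Filter (SimpleFunc ℂ ℂ) :=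
  comap (fun g => eLpNorm (⇑g - f) 2 μ) (𝓝 0)

theorem tendsto_eLpNorm_sub_simpleNhds (f : ℂ → ℂ) (μ : Measure ℂ) :
    Tendsto (fun g : SimpleFunc ℂ ℂ => eLpNorm (⇑g - f) 2 μ) (simpleNhds f μ) (𝓝 0) :=
  tendsto_comap

theorem tendsto_simpleNhds_iff {ι : Type*} {l : Filter ι} {g : ι → SimpleFunc ℂ ℂ} {f : ℂ → ℂ}
    {μ : Measure ℂ} :
    Tendsto g l (simpleNhds f μ) ↔ Tendsto (fun i => eLpNorm (⇑(g i) - f) 2 μ) l (𝓝 0) :=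
  tendsto_comap_iff

theorem simpleNhds_neBot {f : ℂ → ℂ} {μ : Measure ℂ} (hf : MemLp f 2 μ) :
    (simpleNhds f μ).NeBot := by
  refine comap_neBot fun t ht => ?_
  obtain ⟨ε, hε, hεt⟩ := ENNReal.nhds_zero_basis.mem_iff.1 ht
  obtain ⟨g, hg, -⟩ := hf.exists_simpleFunc_eLpNorm_sub_lt (by norm_num) hε.ne'
  exact ⟨g, hεt (by rwa [eLpNorm_sub_comm] at hg)⟩

/-- Simple functions approximating `f` in `L²(μ)` for every `μ` with `f ∈ L²(μ)`. -/
noncomputable def simpleApprox {f : ℂ → ℂ} (hf : Measurable f) (n : ℕ) : SimpleFunc ℂ ℂ :=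
  SimpleFunc.approxOn f hf univ 0 (mem_univ 0) n

theorem tendsto_simpleApprox {f : ℂ → ℂ} (hf : Measurable f) {μ : Measure ℂ} (h : MemLp f 2 μ) :
    Tendsto (simpleApprox hf) atTop (simpleNhds f μ) :=
  tendsto_simpleNhds_iff.2 <| SimpleFunc.tendsto_approxOn_Lp_eLpNorm hf (mem_univ 0) (by norm_num)
    (by simp) (by simpa using h.2)

/-- The value `(∫ f dE) x`, for `x` with `f ∈ L²(E_x)`. -/
noncomputable def integralAt (f : ℂ → ℂ) (x : H) : H :=
  limUnder (simpleNhds f (E.scalarMeasure x)) fun g => E.simpleIntegral g x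

theorem cauchy_map_simpleIntegral {f : ℂ → ℂ} {x : H} (hf : MemLp f 2 (E.scalarMeasure x)) :
    Cauchy (map (fun g => E.simpleIntegral g x) (simpleNhds f (E.scalarMeasure x))) := by
  refine EMetric.cauchy_iff.2 ⟨(simpleNhds_neBot hf).map _ |>.ne, fun ε hε => ?_⟩
  refine ⟨_, image_mem_map (preimage_mem_comap (Iio_mem_nhds (ENNReal.half_pos hε.ne'))), ?_⟩
  rintro _ ⟨g, hg, rfl⟩ _ ⟨k, hk, rfl⟩
  have hadd := eLpNorm_sub_le (p := 2) (μ := E.scalarMeasure x)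
    (g.aestronglyMeasurable.sub hf.1) (k.aestronglyMeasurable.sub hf.1) one_le_two
  rw [sub_sub_sub_cancel_right] at hadd
  calc edist (E.simpleIntegral g x) (E.simpleIntegral k x)
      = eLpNorm (⇑g - ⇑k) 2 (E.scalarMeasure x) := E.edist_simpleIntegral g k x
    _ ≤ _ := hadd
    _ < ε / 2 + ε / 2 := ENNReal.add_lt_add hg hk
    _ = ε := ENNReal.add_halves ε

theorem tendsto_simpleIntegral {f : ℂ → ℂ} {x : H} (hf : MemLp f 2 (E.scalarMeasure x)) :
    Tendsto (fun g => E.simpleIntegral g x) (simpleNhds f (E.scalarMeasure x))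
      (𝓝 (E.integralAt f x)) :=
  tendsto_nhds_limUnder (CompleteSpace.complete (E.cauchy_map_simpleIntegral hf))

theorem tendsto_simpleIntegral_simpleApprox {f : ℂ → ℂ} (hf : Measurable f) {x : H}
    (h : MemLp f 2 (E.scalarMeasure x)) :
    Tendsto (fun n => E.simpleIntegral (simpleApprox hf n) x) atTop (𝓝 (E.integralAt f x)) :=
  (E.tendsto_simpleIntegral h).comp (tendsto_simpleApprox hf h)

theorem tendsto_eLpNorm_simpleNhds {f : ℂ → ℂ} {μ : Measure ℂ} (hf : MemLp f 2 μ) :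
    Tendsto (fun g : SimpleFunc ℂ ℂ => eLpNorm g 2 μ) (simpleNhds f μ) (𝓝 (eLpNorm f 2 μ)) := by
  have hsub := tendsto_eLpNorm_sub_simpleNhds f μ
  have hlower := ENNReal.Tendsto.sub (tendsto_const_nhds (x := eLpNorm f 2 μ)) hsub
    (Or.inl hf.2.ne)
  have hupper := (tendsto_const_nhds (x := eLpNorm f 2 μ)).add hsub
  rw [tsub_zero] at hlower
  rw [add_zero] at hupper
  refine tendsto_of_tendsto_of_tendsto_of_le_of_le hlower hupper (fun g => ?_) (fun g => ?_)
  · have h := eLpNorm_sub_le g.aestronglyMeasurable (g.aestronglyMeasurable.sub hf.1)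
      (p := 2) (μ := μ) one_le_two
    rw [sub_sub_cancel] at h
    exact tsub_le_iff_right.2 h
  · have h := eLpNorm_add_le hf.1 (g.aestronglyMeasurable.sub hf.1) (p := 2) (μ := μ) one_le_two
    rwa [add_sub_cancel] at h

theorem enorm_integralAt {f : ℂ → ℂ} {x : H} (hf : MemLp f 2 (E.scalarMeasure x)) :
    ‖E.integralAt f x‖ₑ = eLpNorm f 2 (E.scalarMeasure x) := by
  have := simpleNhds_neBot hf
  have h := (E.tendsto_simpleIntegral hf).enorm
  simp only [E.enorm_simpleIntegral] at h
  exact tendsto_nhds_unique h (tendsto_eLpNorm_simpleNhds hf)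

theorem integralAt_sub {f g : ℂ → ℂ} {x : H} (hf : MemLp f 2 (E.scalarMeasure x))
    (hg : MemLp g 2 (E.scalarMeasure x)) :
    E.integralAt (f - g) x = E.integralAt f x - E.integralAt g x := by
  set μ := E.scalarMeasure x
  have := simpleNhds_neBot hf
  have := simpleNhds_neBot hg
  have hle : Tendsto (fun p : SimpleFunc ℂ ℂ × SimpleFunc ℂ ℂ => p.1 - p.2)
      (simpleNhds f μ ×ˢ simpleNhds g μ) (simpleNhds (f - g) μ) := by
    have hsum : Tendsto (fun p : SimpleFunc ℂ ℂ × SimpleFunc ℂ ℂ =>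
        eLpNorm (⇑p.1 - f) 2 μ + eLpNorm (⇑p.2 - g) 2 μ)
        (simpleNhds f μ ×ˢ simpleNhds g μ) (𝓝 0) := by
      simpa using ((tendsto_eLpNorm_sub_simpleNhds f μ).comp tendsto_fst).add
        ((tendsto_eLpNorm_sub_simpleNhds g μ).comp tendsto_snd)
    refine tendsto_simpleNhds_iff.2 (tendsto_of_tendsto_of_tendsto_of_le_of_le tendsto_const_nhds
      hsum (fun _ => zero_le) fun p => ?_)
    have h := eLpNorm_sub_le (p := 2) (p.1.aestronglyMeasurable.sub hf.1)
      (p.2.aestronglyMeasurable.sub hg.1) one_le_two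
    rwa [sub_sub_sub_comm] at h
  refine tendsto_nhds_unique ((E.tendsto_simpleIntegral (hf.sub hg)).comp hle) ?_
  simpa only [Function.comp_def, E.simpleIntegral_sub, _root_.sub_apply] using
    ((E.tendsto_simpleIntegral hf).comp tendsto_fst).sub
      ((E.tendsto_simpleIntegral hg).comp tendsto_snd)

theorem edist_integralAt {f g : ℂ → ℂ} {x : H} (hf : MemLp f 2 (E.scalarMeasure x))
    (hg : MemLp g 2 (E.scalarMeasure x)) :
    edist (E.integralAt f x) (E.integralAt g x) = eLpNorm (f - g) 2 (E.scalarMeasure x) := by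
  rw [edist_eq_enorm_sub, ← E.integralAt_sub hf hg, E.enorm_integralAt (hf.sub hg)]

theorem integralAt_congr {f g : ℂ → ℂ} {x : H} (h : f =ᵐ[E.scalarMeasure x] g) :
    E.integralAt f x = E.integralAt g x := by
  have hnhds : simpleNhds f (E.scalarMeasure x) = simpleNhds g (E.scalarMeasure x) := by
    unfold simpleNhds
    congr 1
    ext k
    exact eLpNorm_congr_ae (EventuallyEq.rfl.sub h)
  rw [integralAt, integralAt, hnhds]

theorem integralAt_simpleFunc (g : SimpleFunc ℂ ℂ) (x : H) :
    E.integralAt g x = E.simpleIntegral g x := by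
  have hconst : Tendsto (fun _ : ℕ => g) atTop (simpleNhds g (E.scalarMeasure x)) :=
    tendsto_simpleNhds_iff.2 (by simp)
  exact tendsto_nhds_unique ((E.tendsto_simpleIntegral (g.memLp_of_isFiniteMeasure 2 _)).comp
    hconst) tendsto_const_nhds

theorem memLp_simpleFunc_mul {f : ℂ → ℂ} {μ : Measure ℂ} (hf : MemLp f 2 μ)
    (g : SimpleFunc ℂ ℂ) : MemLp (⇑g * f) 2 μ := by
  obtain ⟨C, hC⟩ := g.exists_forall_norm_le
  refine hf.of_le_mul (c := C) (g.aestronglyMeasurable.mul hf.1) (Eventually.of_forall fun z => ?_)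
  simp only [Pi.mul_apply, norm_mul]
  gcongr
  exact hC z

theorem simpleIntegral_integralAt {f : ℂ → ℂ} {x : H} (hf : MemLp f 2 (E.scalarMeasure x))
    (g : SimpleFunc ℂ ℂ) :
    E.simpleIntegral g (E.integralAt f x) = E.integralAt (⇑g * f) x := by
  have := simpleNhds_neBot hf
  obtain ⟨C, hC⟩ := g.exists_forall_norm_le
  have hmul : Tendsto (fun k => g * k) (simpleNhds f (E.scalarMeasure x))
      (simpleNhds (⇑g * f) (E.scalarMeasure x)) := by
    have hbound : Tendsto (fun k : SimpleFunc ℂ ℂ =>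
        ENNReal.ofReal C * eLpNorm (⇑k - f) 2 (E.scalarMeasure x))
        (simpleNhds f (E.scalarMeasure x)) (𝓝 0) := by
      simpa using ENNReal.Tendsto.const_mul (tendsto_eLpNorm_sub_simpleNhds f _)
        (Or.inr ENNReal.ofReal_ne_top)
    refine tendsto_simpleNhds_iff.2 (tendsto_of_tendsto_of_tendsto_of_le_of_le tendsto_const_nhds
      hbound (fun _ => zero_le) fun k => eLpNorm_le_mul_eLpNorm_of_ae_le_mul
        (Eventually.of_forall fun z => ?_) 2)
    simp only [SimpleFunc.coe_mul, Pi.sub_apply, Pi.mul_apply, ← mul_sub, norm_mul]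
    gcongr
    exact hC z
  refine tendsto_nhds_unique (((E.simpleIntegral g).continuous.tendsto _).comp
    (E.tendsto_simpleIntegral hf)) ?_
  simpa only [Function.comp_def, E.simpleIntegral_mul, mul_apply_eq_comp] using
    (E.tendsto_simpleIntegral (memLp_simpleFunc_mul hf g)).comp hmul

theorem scalarMeasure_integralAt {f : ℂ → ℂ} {x : H} (hf : MemLp f 2 (E.scalarMeasure x)) :
    E.scalarMeasure (E.integralAt f x) = (E.scalarMeasure x).withDensity (fun z => ‖f z‖ₑ ^ 2) := by
  refine Measure.ext fun s hs => ?_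
  have hindicator : ∀ z, ‖(⇑(simpleIndicator 1 hs) * f) z‖ₑ ^ 2 =
      s.indicator (fun z => ‖f z‖ₑ ^ 2) z := fun z => by
    by_cases h : z ∈ s <;> simp [h]
  rw [E.scalarMeasure_apply_enorm _ hs, ← E.simpleIntegral_indicator_one hs,
    E.simpleIntegral_integralAt hf, E.enorm_integralAt (memLp_simpleFunc_mul hf _),
    eLpNorm_two_sq, withDensity_apply _ hs, ← lintegral_indicator hs]
  simp only [hindicator]

theorem eLpNorm_scalarMeasure_integralAt {f g : ℂ → ℂ} (hf : Measurable f) (hg : Measurable g)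
    {x : H} (h : MemLp f 2 (E.scalarMeasure x)) :
    eLpNorm g 2 (E.scalarMeasure (E.integralAt f x)) = eLpNorm (g * f) 2 (E.scalarMeasure x) := by
  refine (ENNReal.pow_right_strictMono two_ne_zero).injective ?_
  rw [eLpNorm_two_sq, eLpNorm_two_sq, E.scalarMeasure_integralAt h,
    lintegral_withDensity_eq_lintegral_mul _ (by fun_prop) (by fun_prop)]
  simp only [Pi.mul_apply, enorm_mul, mul_pow, mul_comm]

theorem memLp_scalarMeasure_integralAt_iff {f g : ℂ → ℂ} (hf : Measurable f) (hg : Measurable g)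
    {x : H} (h : MemLp f 2 (E.scalarMeasure x)) :
    MemLp g 2 (E.scalarMeasure (E.integralAt f x)) ↔ MemLp (g * f) 2 (E.scalarMeasure x) := by
  rw [MemLp, MemLp, E.eLpNorm_scalarMeasure_integralAt hf hg h]
  simp [hg.aestronglyMeasurable, (hg.mul hf).aestronglyMeasurable]

theorem integralAt_integralAt {f g : ℂ → ℂ} (hf : Measurable f) (hg : Measurable g) {x : H}
    (h : MemLp f 2 (E.scalarMeasure x)) (h' : MemLp (g * f) 2 (E.scalarMeasure x)) :
    E.integralAt g (E.integralAt f x) = E.integralAt (g * f) x := by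
  have hmem := (E.memLp_scalarMeasure_integralAt_iff hf hg h).2 h'
  refine tendsto_nhds_unique (E.tendsto_simpleIntegral_simpleApprox hg hmem) ?_
  rw [tendsto_iff_edist_tendsto_0]
  simp only [E.simpleIntegral_integralAt h, E.edist_integralAt (memLp_simpleFunc_mul h _) h',
    ← sub_mul]
  simpa only [E.eLpNorm_scalarMeasure_integralAt hf ((simpleApprox hg _).measurable.sub hg) h]
    using tendsto_simpleNhds_iff.1 (tendsto_simpleApprox hg hmem)

theorem inner_integralAt {f : ℂ → ℂ} (hf : Measurable f) {x y : H}
    (hx : MemLp f 2 (E.scalarMeasure x)) (hy : MemLp f 2 (E.scalarMeasure y)) :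
    inner ℂ x (E.integralAt f y) = inner ℂ (E.integralAt (star f) x) y := by
  have hlim := (tendsto_const_nhds (x := x)).inner (𝕜 := ℂ)
    (E.tendsto_simpleIntegral_simpleApprox hf hy)
  refine tendsto_nhds_unique hlim ?_
  simp only [E.inner_simpleIntegral]
  refine Tendsto.inner ((E.tendsto_simpleIntegral hx.star).comp ?_) tendsto_const_nhds
  refine tendsto_simpleNhds_iff.2 ((tendsto_simpleNhds_iff.1 (tendsto_simpleApprox hf hx)).congr
    fun n => eLpNorm_congr_norm_ae (Eventually.of_forall fun z => ?_))
  change ‖simpleApprox hf n z - f z‖ = ‖star (simpleApprox hf n z) - star (f z)‖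
  rw [← star_sub, norm_star]

theorem inner_integralAt_self {f : ℂ → ℂ} {x : H} (hf : MemLp f 2 (E.scalarMeasure x)) :
    inner ℂ x (E.integralAt f x) = ∫ z, f z ∂(E.scalarMeasure x) := by
  set μ := E.scalarMeasure x
  have := simpleNhds_neBot hf
  have h := (tendsto_const_nhds (x := x)).inner (𝕜 := ℂ) (E.tendsto_simpleIntegral hf)
  refine tendsto_nhds_unique h ?_
  simp only [E.inner_simpleIntegral_self]
  refine tendsto_integral_of_L1' f hf.1
    (Eventually.of_forall fun g => g.integrable_of_isFiniteMeasure) ?_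
  have hbound := ENNReal.Tendsto.mul_const (tendsto_eLpNorm_sub_simpleNhds f μ)
    (b := μ univ ^ (1 / (1 : ENNReal).toReal - 1 / (2 : ENNReal).toReal))
    (Or.inr (by norm_num [ENNReal.rpow_eq_top_iff]))
  rw [zero_mul] at hbound
  exact tendsto_of_tendsto_of_tendsto_of_le_of_le tendsto_const_nhds hbound (fun _ => zero_le)
    fun g => eLpNorm_le_eLpNorm_mul_rpow_measure_univ one_le_two (g.aestronglyMeasurable.sub hf.1)

end ResolutionOfIdentity

/-! ### Projections and null sets -/

namespace ResolutionOfIdentity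

variable {H : Type*} [NormedAddCommGroup H] [InnerProductSpace ℂ H] [CompleteSpace H]
  (E : ResolutionOfIdentity H)

theorem proj_eq_zero_iff {s : Set ℂ} (hs : MeasurableSet s) :
    E.proj s = 0 ↔ ∀ x, E.scalarMeasure x s = 0 := by
  simp [E.scalarMeasure_apply_enorm _ hs, ContinuousLinearMap.ext_iff]

theorem proj_eq_zero_of_subset {s t : Set ℂ} (hs : MeasurableSet s) (ht : MeasurableSet t)
    (hst : s ⊆ t) (h : E.proj t = 0) : E.proj s = 0 :=
  (E.proj_eq_zero_iff hs).2 fun x =>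
    measure_mono_null hst ((E.proj_eq_zero_iff ht).1 h x)

theorem proj_iUnion_eq_zero {s : ℕ → Set ℂ} (hs : ∀ n, MeasurableSet (s n))
    (h : ∀ n, E.proj (s n) = 0) : E.proj (⋃ n, s n) = 0 :=
  (E.proj_eq_zero_iff (MeasurableSet.iUnion hs)).2 fun x =>
    measure_iUnion_null fun n => (E.proj_eq_zero_iff (hs n)).1 (h n) x

theorem ae_of_proj_eq_zero {p : ℂ → Prop} (hp : MeasurableSet {z | ¬ p z})
    (h : E.proj {z | ¬ p z} = 0) (x : H) : ∀ᵐ z ∂(E.scalarMeasure x), p z :=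
  (E.proj_eq_zero_iff hp).1 h x

theorem proj_add_proj_compl {s : Set ℂ} (hs : MeasurableSet s) (x : H) :
    E.proj s x + E.proj sᶜ x = x := by
  rw [← _root_.add_apply, ← E.proj_union hs hs.compl disjoint_compl_right, union_compl_self,
    E.proj_univ, one_apply_eq_self]

theorem proj_proj {s : Set ℂ} (hs : MeasurableSet s) (x : H) :
    E.proj s (E.proj s x) = E.proj s x :=
  congrArg (fun P : H →L[ℂ] H => P x) (E.isStarProjection s hs).isIdempotentElem

theorem norm_proj_le {s : Set ℂ} (hs : MeasurableSet s) (x : H) : ‖E.proj s x‖ ≤ ‖x‖ := by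
  simpa using (E.proj s).le_of_opNorm_le (E.isStarProjection s hs).norm_le x

theorem scalarMeasure_proj {s : Set ℂ} (hs : MeasurableSet s) (x : H) :
    E.scalarMeasure (E.proj s x) = (E.scalarMeasure x).restrict s := by
  refine Measure.ext fun t ht => ?_
  rw [E.scalarMeasure_apply_enorm _ ht, Measure.restrict_apply ht,
    E.scalarMeasure_apply_enorm _ (ht.inter hs), E.proj_inter _ _ ht hs, mul_apply_eq_comp]

theorem ae_scalarMeasure_proj {s : Set ℂ} (hs : MeasurableSet s) (x : H) :
    ∀ᵐ z ∂(E.scalarMeasure (E.proj s x)), z ∈ s := by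
  rw [E.scalarMeasure_proj hs]
  exact ae_restrict_mem hs

theorem tendsto_proj_of_monotone {s : ℕ → Set ℂ} (hs : ∀ n, MeasurableSet (s n))
    (hmono : Monotone s) (hunion : ⋃ n, s n = univ) (x : H) :
    Tendsto (fun n => E.proj (s n) x) atTop (𝓝 x) := by
  have hedist : ∀ n, E.scalarMeasure x (s n)ᶜ = edist (E.proj (s n) x) x ^ 2 := fun n => by
    rw [E.scalarMeasure_apply_enorm x (hs n).compl, edist_comm, edist_eq_enorm_sub,
      ← sub_eq_of_eq_add' (E.proj_add_proj_compl (hs n) x).symm]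
  have hlim : Tendsto (fun n => E.scalarMeasure x (s n)ᶜ) atTop (𝓝 0) := by
    rw [← measure_empty (μ := E.scalarMeasure x), ← compl_univ, ← hunion, compl_iUnion]
    exact tendsto_measure_iInter_atTop (fun n => (hs n).compl.nullMeasurableSet)
      (fun m n hmn => compl_subset_compl.2 (hmono hmn)) ⟨0, measure_ne_top _ _⟩
  rw [tendsto_iff_edist_tendsto_0]
  have hsqrt := (ENNReal.continuous_rpow_const (y := 1 / 2)).tendsto 0 |>.comp hlim
  simp only [Function.comp_def, hedist, ← ENNReal.rpow_natCast, ← ENNReal.rpow_mul] at hsqrt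
  simpa using hsqrt

/-! ### The unbounded operator `∫ f dE` -/

theorem scalarMeasure_add_le (x y : H) :
    E.scalarMeasure (x + y) ≤ (2 : NNReal) • (E.scalarMeasure x + E.scalarMeasure y) := by
  refine Measure.le_iff.2 fun s hs => ?_
  simp only [Measure.smul_apply, Measure.add_apply, E.scalarMeasure_apply _ hs, map_add]
  rw [← ENNReal.ofReal_add (by positivity) (by positivity), ENNReal.smul_def, smul_eq_mul,
    show ((2 : NNReal) : ENNReal) = ENNReal.ofReal 2 by simp, ← ENNReal.ofReal_mul zero_le_two]
  apply ENNReal.ofReal_le_ofReal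
  have hadd := norm_add_le (E.proj s x) (E.proj s y)
  nlinarith [norm_nonneg (E.proj s x + E.proj s y), sq_nonneg (‖E.proj s x‖ - ‖E.proj s y‖)]

theorem scalarMeasure_smul (a : ℂ) (x : H) :
    E.scalarMeasure (a • x) = (‖a‖₊ ^ 2) • E.scalarMeasure x := by
  refine Measure.ext fun s hs => ?_
  simp only [Measure.smul_apply, E.scalarMeasure_apply_enorm _ hs, map_smul, enorm_smul, mul_pow,
    ENNReal.smul_def, smul_eq_mul]
  congr 1

theorem scalarMeasure_zero : E.scalarMeasure 0 = 0 := by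
  refine Measure.ext fun s hs => ?_
  simp [E.scalarMeasure_apply _ hs]

theorem memLp_scalarMeasure_add {f : ℂ → ℂ} {x y : H} (hx : MemLp f 2 (E.scalarMeasure x))
    (hy : MemLp f 2 (E.scalarMeasure y)) : MemLp f 2 (E.scalarMeasure (x + y)) := by
  have hadd := hx.1.add_measure hy.1
  refine MemLp.mono_measure (E.scalarMeasure_add_le x y) (MemLp.smul_measure ?_ (by simp))
  rw [memLp_two_iff hadd, lintegral_add_measure]
  exact ENNReal.add_lt_top.2 ⟨(memLp_two_iff hx.1).1 hx, (memLp_two_iff hy.1).1 hy⟩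

theorem memLp_scalarMeasure_smul {f : ℂ → ℂ} {x : H} (a : ℂ) (hx : MemLp f 2 (E.scalarMeasure x)) :
    MemLp f 2 (E.scalarMeasure (a • x)) := by
  rw [scalarMeasure_smul]
  exact hx.smul_measure (by simp)

/-- The possibly unbounded operator `∫ f dE`, with domain all `x` such that `f ∈ L²(E_x)`. -/
noncomputable def integral (f : ℂ → ℂ) (hf : Measurable f) : H →ₗ.[ℂ] H where
  domain :=
    { carrier := {x | MemLp f 2 (E.scalarMeasure x)}
      add_mem' := fun hx hy => E.memLp_scalarMeasure_add hx hy
      zero_mem' := by simp [E.scalarMeasure_zero]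
      smul_mem' := fun a _ hx => E.memLp_scalarMeasure_smul a hx }
  toFun :=
    { toFun := fun x => E.integralAt f x
      map_add' := fun x y => by
        refine tendsto_nhds_unique
          (E.tendsto_simpleIntegral_simpleApprox hf (E.memLp_scalarMeasure_add x.2 y.2)) ?_
        simpa only [Submodule.coe_add, map_add] using
          (E.tendsto_simpleIntegral_simpleApprox hf x.2).add
            (E.tendsto_simpleIntegral_simpleApprox hf y.2)
      map_smul' := fun a x => by
        refine tendsto_nhds_unique
          (E.tendsto_simpleIntegral_simpleApprox hf (E.memLp_scalarMeasure_smul a x.2)) ?_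
        simpa only [Submodule.coe_smul, map_smul, RingHom.id_apply] using
          (E.tendsto_simpleIntegral_simpleApprox hf x.2).const_smul a }

theorem mem_integral_domain {f : ℂ → ℂ} (hf : Measurable f) {x : H} :
    x ∈ (E.integral f hf).domain ↔ MemLp f 2 (E.scalarMeasure x) := Iff.rfl

theorem integral_apply {f : ℂ → ℂ} (hf : Measurable f) (x : (E.integral f hf).domain) :
    E.integral f hf x = E.integralAt f x := rfl

theorem mem_integral_graph {f : ℂ → ℂ} (hf : Measurable f) {x y : H} :
    (x, y) ∈ (E.integral f hf).graph ↔
      MemLp f 2 (E.scalarMeasure x) ∧ E.integralAt f x = y := by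
  rw [LinearPMap.mem_graph_iff]
  constructor
  · rintro ⟨u, rfl, hu⟩
    exact ⟨u.2, hu⟩
  · rintro ⟨hx, hxy⟩
    exact ⟨⟨x, hx⟩, rfl, hxy⟩

theorem integralAt_one (x : H) : E.integralAt 1 x = x := by
  have huniv : ⇑(simpleIndicator 1 MeasurableSet.univ) = 1 := by
    ext z
    simp
  rw [← huniv, E.integralAt_simpleFunc, E.simpleIntegral_indicator_one, E.proj_univ,
    one_apply_eq_self]

theorem eLpNorm_one (x : H) : eLpNorm (1 : ℂ → ℂ) 2 (E.scalarMeasure x) = ‖x‖ₑ := by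
  rw [← E.enorm_integralAt (f := 1) (memLp_const 1), E.integralAt_one]

theorem norm_integralAt_le {f : ℂ → ℂ} (hf : Measurable f) {x : H} {C : ℝ} (hC : 0 ≤ C)
    (h : ∀ᵐ z ∂(E.scalarMeasure x), ‖f z‖ ≤ C) : ‖E.integralAt f x‖ ≤ C * ‖x‖ := by
  have hle := eLpNorm_le_mul_eLpNorm_of_ae_le_mul (g := (1 : ℂ → ℂ))
    (h.mono fun z hz => by simpa using hz) 2
  rwa [← E.enorm_integralAt (MemLp.of_bound hf.aestronglyMeasurable C h), E.eLpNorm_one,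
    ← ofReal_norm, ← ofReal_norm, ← ENNReal.ofReal_mul hC,
    ENNReal.ofReal_le_ofReal_iff (by positivity)] at hle

theorem le_norm_integralAt {f : ℂ → ℂ} {x : H} {C : ℝ} (hC : 0 < C)
    (hx : MemLp f 2 (E.scalarMeasure x))
    (h : ∀ᵐ z ∂(E.scalarMeasure x), C ≤ ‖f z‖) : C * ‖x‖ ≤ ‖E.integralAt f x‖ := by
  have hle := eLpNorm_le_mul_eLpNorm_of_ae_le_mul (f := (1 : ℂ → ℂ)) (g := f) (c := C⁻¹)
    (h.mono fun z hz => by simpa [inv_mul_eq_div, one_le_div hC] using hz) 2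
  rwa [← E.enorm_integralAt hx, E.eLpNorm_one, ← ofReal_norm, ← ofReal_norm,
    ← ENNReal.ofReal_mul (by positivity), ENNReal.ofReal_le_ofReal_iff (by positivity),
    inv_mul_eq_div, le_div_iff₀' hC] at hle

theorem memLp_scalarMeasure_proj {f : ℂ → ℂ} {x : H} (hf : MemLp f 2 (E.scalarMeasure x))
    {s : Set ℂ} (hs : MeasurableSet s) : MemLp f 2 (E.scalarMeasure (E.proj s x)) := by
  rw [E.scalarMeasure_proj hs]
  exact hf.restrict s

theorem memLp_scalarMeasure_proj_of_bound {f : ℂ → ℂ} (hf : Measurable f) {s : Set ℂ}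
    (hs : MeasurableSet s) {C : ℝ} (h : ∀ z ∈ s, ‖f z‖ ≤ C) (x : H) :
    MemLp f 2 (E.scalarMeasure (E.proj s x)) :=
  MemLp.of_bound hf.aestronglyMeasurable C ((E.ae_scalarMeasure_proj hs x).mono h)

theorem proj_integralAt {f : ℂ → ℂ} (hf : Measurable f) {s : Set ℂ} (hs : MeasurableSet s) {x : H}
    (hx : MemLp f 2 (E.scalarMeasure x)) :
    E.proj s (E.integralAt f x) = E.integralAt f (E.proj s x) := by
  have hmul := memLp_simpleFunc_mul hx (simpleIndicator 1 hs)
  rw [← E.simpleIntegral_indicator_one hs, E.simpleIntegral_integralAt hx,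
    ← E.integralAt_simpleFunc, mul_comm,
    E.integralAt_integralAt (SimpleFunc.measurable _) hf (SimpleFunc.memLp_of_isFiniteMeasure _ _ _)
      (by rwa [mul_comm])]

theorem measurableSet_norm_le {f : ℂ → ℂ} (hf : Measurable f) (C : ℝ) :
    MeasurableSet {z | ‖f z‖ ≤ C} := measurableSet_le hf.norm measurable_const

theorem measurableSet_lt_norm {f : ℂ → ℂ} (hf : Measurable f) (C : ℝ) :
    MeasurableSet {z | C < ‖f z‖} := measurableSet_lt measurable_const hf.norm

theorem iUnion_norm_le (f : ℂ → ℂ) : ⋃ n : ℕ, {z | ‖f z‖ ≤ n} = univ :=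
  eq_univ_of_forall fun z => mem_iUnion.2 (exists_nat_ge ‖f z‖)

theorem monotone_norm_le (f : ℂ → ℂ) : Monotone fun n : ℕ => {z | ‖f z‖ ≤ n} :=
  fun _ _ hmn _ (hz : ‖f _‖ ≤ _) => hz.trans (Nat.cast_le.2 hmn)

theorem dense_integral_domain {f : ℂ → ℂ} (hf : Measurable f) :
    Dense ((E.integral f hf).domain : Set H) := fun x =>
  mem_closure_of_tendsto (E.tendsto_proj_of_monotone (fun n : ℕ => measurableSet_norm_le hf n)
    (monotone_norm_le f) (iUnion_norm_le f) x)
    (Eventually.of_forall fun n => E.memLp_scalarMeasure_proj_of_bound hf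
      (measurableSet_norm_le hf n) (fun _ hz => hz) x)

end ResolutionOfIdentity

section QuadraticForm

variable {H : Type*} [NormedAddCommGroup H] [InnerProductSpace ℂ H]

theorem eq_of_inner_self_eq {A B : H →ₗ.[ℂ] H} (hdom : A.domain = B.domain)
    (hdense : Dense (A.domain : Set H))
    (h : ∀ x (hA : x ∈ A.domain) (hB : x ∈ B.domain),
      inner ℂ x (A ⟨x, hA⟩) = inner ℂ x (B ⟨x, hB⟩)) : A = B := by
  obtain ⟨D, A⟩ := A
  obtain ⟨D', B⟩ := B
  obtain rfl : D = D' := hdom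
  have hquad : ∀ x : D, inner ℂ (x : H) ((A - B) x) = 0 := fun x => by
    rw [LinearMap.sub_apply, inner_sub_right, sub_eq_zero]
    exact h x x.2 x.2
  have hzero : A - B = 0 := by
    ext x
    refine hdense.eq_zero_of_inner_right (𝕜 := ℂ) fun y hy => ?_
    have hadd := hquad (x + ⟨y, hy⟩)
    have haddI := hquad (x + Complex.I • ⟨y, hy⟩)
    simp only [map_add, map_smul, Submodule.coe_add, Submodule.coe_smul, inner_add_left,
      inner_add_right, inner_smul_left, inner_smul_right, hquad x, hquad ⟨y, hy⟩,
      Complex.conj_I] at hadd haddI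
    linear_combination (1 / 2) * hadd + (Complex.I / 2) * haddI +
      (1 / 2) * (inner ℂ y ((A - B) x) - inner ℂ (x : H) ((A - B) ⟨y, hy⟩)) * Complex.I_mul_I
  rw [sub_eq_zero.1 hzero]

end QuadraticForm

namespace ResolutionOfIdentity

variable {H : Type*} [NormedAddCommGroup H] [InnerProductSpace ℂ H] [CompleteSpace H]
  {E : ResolutionOfIdentity H}

theorem isIntegral_integral {f : ℂ → ℂ} (hf : Measurable f) : E.IsIntegral f (E.integral f hf) :=
  ⟨hf, fun _ => memLp_two_iff hf.aestronglyMeasurable, fun x => E.inner_integralAt_self x.2⟩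

theorem IsIntegral.eq_integral {f : ℂ → ℂ} {A : H →ₗ.[ℂ] H} (h : E.IsIntegral f A) :
    A = E.integral f h.1 := by
  have hdom : A.domain = (E.integral f h.1).domain := by
    ext x
    rw [h.2.1, E.mem_integral_domain, memLp_two_iff h.1.aestronglyMeasurable]
  refine eq_of_inner_self_eq hdom (by rw [hdom]; exact E.dense_integral_domain h.1)
    fun x hA hB => ?_
  rw [h.2.2 ⟨x, hA⟩, E.integral_apply, E.inner_integralAt_self hB]

theorem IsIntegral.affine {f : ℂ → ℂ} {A : H →ₗ.[ℂ] H} (h : E.IsIntegral f A) (α : ℂ) {β : ℂ}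
    (hβ : β ≠ 0) : E.IsIntegral (fun z => α + β * f z) (affine α β A) := by
  have hm : Measurable fun z => α + β * f z := (h.1.const_mul β).const_add α
  have hmem : ∀ x, MemLp (fun z => α + β * f z) 2 (E.scalarMeasure x) ↔
      MemLp f 2 (E.scalarMeasure x) := fun x => by
    refine ⟨fun hx => ?_, fun hx => (memLp_const α).add (hx.const_mul β)⟩
    refine (memLp_congr_ae (Eventually.of_forall fun z => ?_)).1
      ((hx.sub (memLp_const α)).const_mul β⁻¹)
    simp [hβ]
  refine ⟨hm, fun x => ?_, fun x => ?_⟩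
  · rw [← memLp_two_iff hm.aestronglyMeasurable, hmem, memLp_two_iff h.1.aestronglyMeasurable,
      ← h.2.1]
    rfl
  · have hx : (x : H) ∈ A.domain := x.2
    have hfx : MemLp f 2 (E.scalarMeasure (x : H)) :=
      (memLp_two_iff h.1.aestronglyMeasurable).2 ((h.2.1 x).1 hx)
    have hone := E.inner_integralAt_self (f := 1) (x := x) (memLp_const 1)
    rw [E.integralAt_one] at hone
    change inner ℂ (x : H) (α • (x : H) + β • A ⟨x, hx⟩) = _
    rw [inner_add_right, inner_smul_right, inner_smul_right, h.2.2 ⟨x, hx⟩,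
      integral_add (integrable_const α) ((hfx.integrable one_le_two).const_mul β),
      integral_const_mul, hone]
    simp [mul_comm]

variable (E)

/-! ### Adjoints and normality -/

theorem measurable_star {f : ℂ → ℂ} (hf : Measurable f) : Measurable (star f) :=
  continuous_star.measurable.comp hf

theorem memLp_star_iff {f : ℂ → ℂ} {μ : Measure ℂ} : MemLp (star f) 2 μ ↔ MemLp f 2 μ :=
  ⟨fun h => by simpa using h.star, MemLp.star⟩

theorem integral_star_le_adjoint {f : ℂ → ℂ} (hf : Measurable f) :
    E.integral (star f) (measurable_star hf) ≤ (E.integral f hf).adjoint := by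
  refine LinearPMap.IsFormalAdjoint.le_adjoint (E.dense_integral_domain hf) fun x y => ?_
  rw [E.integral_apply, E.integral_apply, ← inner_conj_symm,
    E.inner_integralAt hf (memLp_star_iff.1 y.2) x.2, inner_conj_symm]

theorem proj_adjoint_integral {f : ℂ → ℂ} (hf : Measurable f) {s : Set ℂ} (hs : MeasurableSet s)
    {C : ℝ} (h : ∀ z ∈ s, ‖f z‖ ≤ C) (y : (E.integral f hf).adjoint.domain) :
    E.proj s ((E.integral f hf).adjoint y) = E.integralAt (star f) (E.proj s y) := by
  have hmem := E.memLp_scalarMeasure_proj_of_bound hf hs h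
  have hstar := fun x => memLp_star_iff.2 (hmem x)
  refine ext_inner_right ℂ fun x => ?_
  calc inner ℂ (E.proj s ((E.integral f hf).adjoint y)) x
      = inner ℂ ((E.integral f hf).adjoint y) (E.proj s x) := (E.inner_proj_right hs _ _).symm
    _ = inner ℂ (y : H) (E.integralAt f (E.proj s x)) :=
        LinearPMap.adjoint_isFormalAdjoint (E.dense_integral_domain hf) y ⟨_, hmem x⟩
    _ = inner ℂ (E.proj s y) (E.integralAt f (E.proj s x)) := by
        rw [← E.inner_proj_right hs, E.proj_integralAt hf hs (hmem x), E.proj_proj hs]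
    _ = inner ℂ (E.integralAt (star f) (E.proj s y)) (E.proj s x) :=
        E.inner_integralAt hf (hmem y) (hmem x)
    _ = inner ℂ (E.integralAt (star f) (E.proj s y)) x := by
        rw [E.inner_proj_right hs, E.proj_integralAt (measurable_star hf) hs (hstar y),
          E.proj_proj hs]

theorem eLpNorm_two_le_of_forall_restrict {α : Type*} [MeasurableSpace α] {μ : Measure α}
    {f : α → ℂ} {s : ℕ → Set α} (hmono : Monotone s) (hunion : ⋃ n, s n = univ) {C : ENNReal}
    (h : ∀ n, eLpNorm f 2 (μ.restrict (s n)) ≤ C) : eLpNorm f 2 μ ≤ C := by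
  refine (ENNReal.pow_le_pow_left_iff two_ne_zero).1 ?_
  rw [eLpNorm_two_sq, ← setLIntegral_univ, ← hunion,
    setLIntegral_iUnion_of_directed _ (directed_of_isDirected_le hmono)]
  refine iSup_le fun n => ?_
  rw [← eLpNorm_two_sq]
  gcongr
  exact h n

theorem adjoint_integral {f : ℂ → ℂ} (hf : Measurable f) :
    (E.integral f hf).adjoint = E.integral (star f) (measurable_star hf) := by
  have hle := E.integral_star_le_adjoint hf
  refine (LinearPMap.eq_of_le_of_domain_eq hle (le_antisymm hle.1 fun y hy => ?_)).symm
  have hlevel : ∀ n : ℕ, eLpNorm (star f) 2 ((E.scalarMeasure y).restrict {z | ‖f z‖ ≤ n}) ≤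
      ‖(E.integral f hf).adjoint ⟨y, hy⟩‖ₑ := fun n => by
    have hs := measurableSet_norm_le hf n
    rw [← E.scalarMeasure_proj hs, ← E.enorm_integralAt (memLp_star_iff.2
      (E.memLp_scalarMeasure_proj_of_bound hf hs (fun _ hz => hz) y)),
      ← E.proj_adjoint_integral hf hs (fun _ hz => hz) ⟨y, hy⟩, enorm_le_iff_norm_le]
    exact E.norm_proj_le hs _
  exact ⟨(measurable_star hf).aestronglyMeasurable, (eLpNorm_two_le_of_forall_restrict
    (monotone_norm_le f) (iUnion_norm_le f) hlevel).trans_lt enorm_lt_top⟩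

theorem exists_mem_integral_graph_iff {f g : ℂ → ℂ} (hf : Measurable f) (hg : Measurable g)
    {x z : H} :
    (∃ y, (x, y) ∈ (E.integral f hf).graph ∧ (y, z) ∈ (E.integral g hg).graph) ↔
      MemLp f 2 (E.scalarMeasure x) ∧ MemLp (g * f) 2 (E.scalarMeasure x) ∧
        E.integralAt (g * f) x = z := by
  simp only [E.mem_integral_graph]
  constructor
  · rintro ⟨_, ⟨hx, rfl⟩, hy, rfl⟩
    have hgf := (E.memLp_scalarMeasure_integralAt_iff hf hg hx).1 hy
    exact ⟨hx, hgf, (E.integralAt_integralAt hf hg hx hgf).symm⟩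
  · rintro ⟨hx, hgf, rfl⟩
    exact ⟨_, ⟨hx, rfl⟩, (E.memLp_scalarMeasure_integralAt_iff hf hg hx).2 hgf,
      E.integralAt_integralAt hf hg hx hgf⟩

theorem isNormal_integral {f : ℂ → ℂ} (hf : Measurable f) : IsNormal (E.integral f hf) := by
  refine ⟨?_, E.dense_integral_domain hf, fun x z => ?_⟩
  · have hstar := E.adjoint_integral (measurable_star hf)
    simp only [star_star] at hstar
    rw [← hstar]
    exact LinearPMap.adjoint_isClosed (E.dense_integral_domain (measurable_star hf))
  · rw [E.adjoint_integral hf, E.exists_mem_integral_graph_iff hf (measurable_star hf),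
      E.exists_mem_integral_graph_iff (measurable_star hf) hf, memLp_star_iff, mul_comm]

/-! ### Boundedness and invertibility -/

theorem integral_domain_eq_top {f : ℂ → ℂ} (hf : Measurable f) {C : ℝ}
    (h : E.proj {z | C < ‖f z‖} = 0) : (E.integral f hf).domain = ⊤ := by
  simp only [← not_le] at h
  exact eq_top_iff.2 fun x _ => MemLp.of_bound hf.aestronglyMeasurable C
    (E.ae_of_proj_eq_zero (measurableSet_norm_le hf C).compl h x)

theorem isBounded_integral {f : ℂ → ℂ} (hf : Measurable f) {C : ℝ} (hC : 0 ≤ C)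
    (h : E.proj {z | C < ‖f z‖} = 0) : IsBounded (E.integral f hf) := by
  simp only [← not_le] at h
  exact ⟨C, fun x => E.norm_integralAt_le hf hC
    (E.ae_of_proj_eq_zero (measurableSet_norm_le hf C).compl h x)⟩

theorem exists_proj_eq_zero_of_isBounded {f : ℂ → ℂ} (hf : Measurable f)
    (h : IsBounded (E.integral f hf)) : ∃ C : ℝ, E.proj {z | C < ‖f z‖} = 0 := by
  obtain ⟨C, hC⟩ := h
  set C' := max C 0 + 1
  have hms : ∀ n : ℕ, MeasurableSet ({z | C' < ‖f z‖} ∩ {z | ‖f z‖ ≤ n}) := fun n =>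
    (measurableSet_lt_norm hf C').inter (measurableSet_norm_le hf n)
  refine ⟨C', ?_⟩
  rw [← inter_univ {z | C' < ‖f z‖}, ← iUnion_norm_le f, inter_iUnion]
  refine E.proj_iUnion_eq_zero hms fun n => ContinuousLinearMap.ext fun x => ?_
  set v := E.proj ({z | C' < ‖f z‖} ∩ {z | ‖f z‖ ≤ n}) x
  have hv : MemLp f 2 (E.scalarMeasure v) :=
    E.memLp_scalarMeasure_proj_of_bound hf (hms n) (fun _ hz => hz.2) x
  have hlower : C' * ‖v‖ ≤ ‖E.integralAt f v‖ :=
    E.le_norm_integralAt (by positivity) hv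
      ((E.ae_scalarMeasure_proj (hms n) x).mono fun z hz => hz.1.le)
  have hupper : ‖E.integralAt f v‖ ≤ C * ‖v‖ := hC ⟨v, hv⟩
  have hlt : C < C' := (le_max_left C 0).trans_lt (lt_add_one _)
  have hzero : ‖v‖ ≤ 0 := by nlinarith [norm_nonneg v]
  exact norm_le_zero_iff.1 hzero

theorem exists_proj_eq_zero_of_isInvertible {f : ℂ → ℂ} (hf : Measurable f)
    (h : IsInvertible (E.integral f hf)) : ∃ ε > 0, E.proj {z | ‖f z‖ ≤ ε} = 0 := by
  obtain ⟨B, -, hB⟩ := h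
  set ε := 1 / (‖B‖ + 1) with hε
  have hms := measurableSet_norm_le hf ε
  refine ⟨ε, by positivity, ContinuousLinearMap.ext fun x => ?_⟩
  set v := E.proj {z | ‖f z‖ ≤ ε} x
  have hv : MemLp f 2 (E.scalarMeasure v) :=
    E.memLp_scalarMeasure_proj_of_bound hf hms (fun _ hz => hz) x
  have hupper : ‖E.integralAt f v‖ ≤ ε * ‖v‖ :=
    E.norm_integralAt_le hf (by positivity) (E.ae_scalarMeasure_proj hms x)
  have hBv : B (E.integralAt f v) = v := hB ⟨v, hv⟩
  have hlower : ‖v‖ ≤ ‖B‖ * (ε * ‖v‖) := by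
    conv_lhs => rw [← hBv]
    exact (B.le_opNorm _).trans (by gcongr)
  have hcontract : (‖B‖ + 1) * ‖v‖ ≤ ‖B‖ * ‖v‖ := by
    calc (‖B‖ + 1) * ‖v‖ ≤ (‖B‖ + 1) * (‖B‖ * (ε * ‖v‖)) := by gcongr
      _ = ‖B‖ * ‖v‖ := by rw [hε]; field_simp
  exact norm_le_zero_iff.1 (by linarith)

theorem isInvertible_integral {f : ℂ → ℂ} (hf : Measurable f) {ε : ℝ} (hε : 0 < ε)
    (h : E.proj {z | ‖f z‖ < ε} = 0) : IsInvertible (E.integral f hf) := by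
  simp only [← not_le] at h
  have hae := E.ae_of_proj_eq_zero (measurableSet_le measurable_const hf.norm).compl h
  have hinv : Measurable f⁻¹ := hf.inv
  have hbound : ∀ x, ∀ᵐ z ∂(E.scalarMeasure x), ‖f⁻¹ z‖ ≤ ε⁻¹ := fun x =>
    (hae x).mono fun z hz => by
      rw [Pi.inv_apply, norm_inv]
      exact inv_anti₀ hε hz
  have hmem : ∀ x, MemLp f⁻¹ 2 (E.scalarMeasure x) := fun x =>
    MemLp.of_bound hinv.aestronglyMeasurable _ (hbound x)
  have hone : ∀ x, f * f⁻¹ =ᵐ[E.scalarMeasure x] 1 := fun x =>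
    (hae x).mono fun z hz => mul_inv_cancel₀ (norm_pos_iff.1 (hε.trans_le hz))
  have hmem_one : ∀ x, MemLp (f * f⁻¹) 2 (E.scalarMeasure x) := fun x =>
    (memLp_congr_ae (hone x)).2 (memLp_const 1)
  let B : H →ₗ[ℂ] H :=
    { toFun := fun x => E.integralAt f⁻¹ x
      map_add' := fun x y => (E.integral _ hinv).map_add ⟨x, hmem x⟩ ⟨y, hmem y⟩
      map_smul' := fun a x => (E.integral _ hinv).map_smul a ⟨x, hmem x⟩ }
  refine ⟨B.mkContinuous ε⁻¹ fun x => E.norm_integralAt_le hinv (by positivity) (hbound x),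
    fun u => ⟨?_, ?_⟩, fun v => ?_⟩
  · exact (E.memLp_scalarMeasure_integralAt_iff hinv hf (hmem u)).2 (hmem_one u)
  · change E.integralAt f (E.integralAt f⁻¹ u) = u
    rw [E.integralAt_integralAt hinv hf (hmem u) (hmem_one u), E.integralAt_congr (hone u),
      E.integralAt_one]
  · change E.integralAt f⁻¹ (E.integralAt f v) = v
    have hone' := hone v
    have hmem_one' := hmem_one (v : H)
    rw [mul_comm] at hone' hmem_one'
    rw [E.integralAt_integralAt hf hinv v.2 hmem_one', E.integralAt_congr hone', E.integralAt_one]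

/-! ### Pushforward -/

/-- The pushforward of a resolution of the identity under a measurable map. -/
def map (m : ℂ → ℂ) (hm : Measurable m) : ResolutionOfIdentity H where
  proj s := E.proj (m ⁻¹' s)
  isStarProjection s hs := E.isStarProjection _ (hm hs)
  proj_univ := E.proj_univ
  proj_inter s t hs ht := E.proj_inter _ _ (hm hs) (hm ht)
  hasSum_proj s hs hd x := by
    simpa only [preimage_iUnion] using E.hasSum_proj (fun n => m ⁻¹' s n) (fun n => hm (hs n))
      (fun i j hij => (hd hij).preimage m) x

theorem scalarMeasure_map {m : ℂ → ℂ} (hm : Measurable m) (x : H) :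
    (E.map m hm).scalarMeasure x = (E.scalarMeasure x).map m := by
  refine Measure.ext fun s hs => ?_
  rw [Measure.map_apply hm hs, scalarMeasure_apply_enorm _ _ hs,
    scalarMeasure_apply_enorm _ _ (hm hs)]
  rfl

theorem isIntegral_map_iff {m f : ℂ → ℂ} (hm : Measurable m) (hf : Measurable f)
    {A : H →ₗ.[ℂ] H} : (E.map m hm).IsIntegral f A ↔ E.IsIntegral (f ∘ m) A := by
  simp only [IsIntegral, scalarMeasure_map, hf, hf.comp hm, true_and,
    lintegral_map (hf.enorm.pow_const 2) hm,
    integral_map hm.aemeasurable hf.aestronglyMeasurable, Function.comp_apply]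

end ResolutionOfIdentity

/-! ### Uniqueness of the resolution of the identity -/

theorem borel_eq_generateFrom_closedBall (X : Type*) [PseudoMetricSpace X]
    [SecondCountableTopology X] :
    borel X = MeasurableSpace.generateFrom
      {s | ∃ (x : X) (r : ℝ), 0 ≤ r ∧ s = Metric.closedBall x r} := by
  refine le_antisymm (MeasurableSpace.generateFrom_le fun U (hU : IsOpen U) => ?_)
    (MeasurableSpace.generateFrom_le ?_)
  · have hball : ∀ x ∈ U, ∃ r > 0, Metric.closedBall x r ⊆ U := fun x hx =>
      Metric.nhds_basis_closedBall.mem_iff.1 (hU.mem_nhds hx)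
    choose! r hr hrU using hball
    obtain ⟨t, htU, ht, hcover⟩ := TopologicalSpace.countable_cover_nhdsWithin
      (f := fun x => Metric.closedBall x (r x)) fun x hx =>
        mem_nhdsWithin_of_mem_nhds (Metric.closedBall_mem_nhds x (hr x hx))
    rw [hcover.antisymm (iUnion₂_subset fun x hx => hrU x (htU hx))]
    exact MeasurableSet.biUnion ht fun x hx =>
      MeasurableSpace.measurableSet_generateFrom ⟨x, r x, (hr x (htU hx)).le, rfl⟩
  · rintro _ ⟨x, r, -, rfl⟩
    borelize X
    exact Metric.isClosed_closedBall.measurableSet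

namespace ResolutionOfIdentity

variable {H : Type*} [NormedAddCommGroup H] [InnerProductSpace ℂ H] [CompleteSpace H]
  {E F : ResolutionOfIdentity H}

variable (E) in
theorem proj_le_norm_apply_eq_zero {f : ℂ → ℂ} (hf : Measurable f) {x : H} {C r s : ℝ}
    (hr : 0 ≤ r) (hrs : r < s) (hmem : ∀ n : ℕ, MemLp (f ^ n) 2 (E.scalarMeasure x))
    (hgrowth : ∀ n : ℕ, ‖E.integralAt (f ^ n) x‖ ≤ r ^ n * C) :
    E.proj {z | s ≤ ‖f z‖} x = 0 := by
  have hs : 0 < s := hr.trans_lt hrs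
  have hS : MeasurableSet {z | s ≤ ‖f z‖} := measurableSet_le measurable_const hf.norm
  set y := E.proj {z | s ≤ ‖f z‖} x
  have hbound : ∀ n : ℕ, ‖y‖ ≤ (r / s) ^ n * C := fun n => by
    have hpow : Measurable (f ^ n) := hf.pow_const n
    have hlower : s ^ n * ‖y‖ ≤ ‖E.integralAt (f ^ n) y‖ :=
      E.le_norm_integralAt (by positivity) (E.memLp_scalarMeasure_proj (hmem n) hS)
        ((E.ae_scalarMeasure_proj hS x).mono fun z hz => by
          rw [Pi.pow_apply, norm_pow]
          exact pow_le_pow_left₀ hs.le hz n)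
    have hupper : ‖E.integralAt (f ^ n) y‖ ≤ r ^ n * C := by
      rw [← E.proj_integralAt hpow hS (hmem n)]
      exact (E.norm_proj_le hS _).trans (hgrowth n)
    rw [div_pow, div_mul_eq_mul_div, le_div_iff₀' (by positivity)]
    exact hlower.trans hupper
  have hlim : Tendsto (fun n : ℕ => (r / s) ^ n * C) atTop (𝓝 0) := by
    simpa using (tendsto_pow_atTop_nhds_zero_of_lt_one (by positivity)
      ((div_lt_one hs).2 hrs)).mul_const C
  exact norm_le_zero_iff.1 (ge_of_tendsto' hlim hbound)

variable (E) in
theorem proj_norm_le_apply_eq_self {f : ℂ → ℂ} (hf : Measurable f) {x : H} {C r : ℝ}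
    (hr : 0 ≤ r) (hmem : ∀ n : ℕ, MemLp (f ^ n) 2 (E.scalarMeasure x))
    (hgrowth : ∀ n : ℕ, ‖E.integralAt (f ^ n) x‖ ≤ r ^ n * C) :
    E.proj {z | ‖f z‖ ≤ r} x = x := by
  have hS := measurableSet_norm_le hf r
  have hcompl : {z | ‖f z‖ ≤ r}ᶜ ⊆ ⋃ k : ℕ, {z | r + 1 / (k + 1) ≤ ‖f z‖} := by
    intro z (hz : ¬ ‖f z‖ ≤ r)
    obtain ⟨k, hk⟩ := exists_nat_one_div_lt (sub_pos.2 (not_le.1 hz))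
    exact mem_iUnion.2 ⟨k, (lt_sub_iff_add_lt'.1 hk).le⟩
  have hnull : E.scalarMeasure x {z | ‖f z‖ ≤ r}ᶜ = 0 :=
    measure_mono_null hcompl (measure_iUnion_null fun k => by
      rw [E.scalarMeasure_apply_enorm _ (measurableSet_le measurable_const hf.norm),
        E.proj_le_norm_apply_eq_zero hf hr (lt_add_of_pos_right r Nat.one_div_pos_of_nat) hmem
          hgrowth]
      simp)
  rw [E.scalarMeasure_apply_enorm _ hS.compl, sq_eq_zero_iff, enorm_eq_zero] at hnull
  simpa only [hnull, add_zero] using E.proj_add_proj_compl hS x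

variable (E) in
theorem integralAt_pow_eq_of_graph {f : ℂ → ℂ} (hf : Measurable f) {u : ℕ → H}
    (hu : ∀ n, (u n, u (n + 1)) ∈ (E.integral f hf).graph) (n : ℕ) :
    MemLp (f ^ n) 2 (E.scalarMeasure (u 0)) ∧ E.integralAt (f ^ n) (u 0) = u n := by
  induction n with
  | zero => exact ⟨memLp_const 1, by rw [pow_zero, E.integralAt_one]⟩
  | succ n ih =>
    have hpow : Measurable (f ^ n) := hf.pow_const n
    obtain ⟨hmem, hun⟩ := ih
    obtain ⟨hmem', hun'⟩ := (E.mem_integral_graph hf).1 (hu n)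
    rw [← hun, E.memLp_scalarMeasure_integralAt_iff hpow hf hmem] at hmem'
    rw [← hun', ← hun, pow_succ', E.integralAt_integralAt hpow hf hmem hmem']
    exact ⟨hmem', rfl⟩

/-- The range of the spectral projection onto `{‖f‖ ≤ r}` can be read off the operator `∫ f dE`
alone, as the set of vectors on which its powers grow no faster than those of `r`. -/
theorem IsIntegral.proj_norm_le_apply_eq_self_iff {f : ℂ → ℂ} {A : H →ₗ.[ℂ] H}
    (h : E.IsIntegral f A) {r : ℝ} (hr : 0 ≤ r) {x : H} :
    E.proj {z | ‖f z‖ ≤ r} x = x ↔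
      ∃ u : ℕ → H, u 0 = x ∧ (∀ n, (u n, u (n + 1)) ∈ A.graph) ∧ ∀ n, ‖u n‖ ≤ r ^ n * ‖x‖ := by
  have hf := h.1
  have hpow : ∀ n : ℕ, Measurable (f ^ n) := fun n => hf.pow_const n
  rw [h.eq_integral]
  constructor
  · intro hx
    have hae : ∀ n : ℕ, ∀ᵐ z ∂(E.scalarMeasure x), ‖(f ^ n) z‖ ≤ r ^ n := fun n => by
      rw [← hx]
      exact (E.ae_scalarMeasure_proj (measurableSet_norm_le hf r) x).mono fun z hz => by
        rw [Pi.pow_apply, norm_pow]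
        exact pow_le_pow_left₀ (norm_nonneg _) hz n
    have hmem : ∀ n : ℕ, MemLp (f ^ n) 2 (E.scalarMeasure x) := fun n =>
      MemLp.of_bound (hpow n).aestronglyMeasurable _ (hae n)
    refine ⟨fun n => E.integralAt (f ^ n) x, ?_, fun n => ?_,
      fun n => E.norm_integralAt_le (hpow n) (by positivity) (hae n)⟩
    · simp only [pow_zero, E.integralAt_one]
    · have hsucc := hmem (n + 1)
      rw [pow_succ'] at hsucc
      simp only [E.mem_integral_graph, pow_succ',
        E.memLp_scalarMeasure_integralAt_iff (hpow n) hf (hmem n)]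
      exact ⟨hsucc, E.integralAt_integralAt (hpow n) hf (hmem n) hsucc⟩
  · rintro ⟨u, rfl, hgraph, hgrowth⟩
    have horbit := E.integralAt_pow_eq_of_graph hf hgraph
    exact E.proj_norm_le_apply_eq_self hf hr (fun n => (horbit n).1) fun n => by
      rw [(horbit n).2]
      exact hgrowth n

theorem IsIntegral.proj_closedBall_eq {N : H →ₗ.[ℂ] H} (hE : E.IsIntegral id N)
    (hF : F.IsIntegral id N) (z : ℂ) {r : ℝ} (hr : 0 ≤ r) :
    E.proj (Metric.closedBall z r) = F.proj (Metric.closedBall z r) := by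
  have hball : Metric.closedBall z r = {w | ‖-z + 1 * id w‖ ≤ r} := by
    ext w
    simp [dist_eq_norm, neg_add_eq_sub]
  have hmeas : MeasurableSet (Metric.closedBall z r) := Metric.isClosed_closedBall.measurableSet
  have hrange : ∀ x, E.proj (Metric.closedBall z r) x = x ↔
      F.proj (Metric.closedBall z r) x = x := fun x => by
    rw [hball, (hE.affine (-z) one_ne_zero).proj_norm_le_apply_eq_self_iff hr,
      (hF.affine (-z) one_ne_zero).proj_norm_le_apply_eq_self_iff hr]
  refine (ContinuousLinearMap.IsStarProjection.ext_iff (E.isStarProjection _ hmeas)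
    (F.isStarProjection _ hmeas)).2 (Submodule.ext fun x => ?_)
  simp only [LinearMap.mem_range]
  exact ⟨fun ⟨y, hy⟩ => ⟨x, (hrange x).1 (hy ▸ E.proj_proj hmeas y)⟩,
    fun ⟨y, hy⟩ => ⟨x, (hrange x).2 (hy ▸ F.proj_proj hmeas y)⟩⟩

theorem IsIntegral.scalarMeasure_eq {N : H →ₗ.[ℂ] H} (hE : E.IsIntegral id N)
    (hF : F.IsIntegral id N) : E.scalarMeasure = F.scalarMeasure := by
  ext1 x
  refine ext_of_generate_finite _
    ((borel_eq_generateFrom_closedBall ℂ).trans generateFrom_generatePiSystem_eq.symm)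
    (isPiSystem_generatePiSystem _) (fun s hs => ?_) ?_
  · suffices h : MeasurableSet s ∧ E.proj s = F.proj s by
      rw [scalarMeasure_apply _ _ h.1, scalarMeasure_apply _ _ h.1, h.2]
    induction hs with
    | base hs =>
      obtain ⟨z, r, hr, rfl⟩ := hs
      exact ⟨Metric.isClosed_closedBall.measurableSet, hE.proj_closedBall_eq hF z hr⟩
    | inter _ _ _ ihs iht =>
      exact ⟨ihs.1.inter iht.1, by
        rw [E.proj_inter _ _ ihs.1 iht.1, F.proj_inter _ _ ihs.1 iht.1, ihs.2, iht.2]⟩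
  · rw [scalarMeasure_apply _ _ MeasurableSet.univ, scalarMeasure_apply _ _ MeasurableSet.univ,
      E.proj_univ, F.proj_univ]

theorem isIntegral_functionalCalculus {N : H →ₗ.[ℂ] H} (hN : E.IsIntegral id N) {f : ℂ → ℂ}
    (hf : Measurable f) : E.IsIntegral f (functionalCalculus f N) := by
  have hex : ∃ A, IsFunctionOf N f A :=
    ⟨E.integral f hf, E, hN, isIntegral_integral hf⟩
  obtain ⟨F, hFN, hF⟩ := hex.choose_spec
  rw [functionalCalculus, dif_pos hex]
  simpa only [IsIntegral, hN.scalarMeasure_eq hFN] using hF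

end ResolutionOfIdentity

/-! ### Multiplication operators on `L²` -/

theorem hasSum_of_enorm_sq_eq_measure {α V : Type*} [MeasurableSpace α] [NormedAddCommGroup V]
    {ν : Measure α} [IsFiniteMeasure ν] {P : Set α → V} (hP : FinMeasAdditive ν P)
    (hν : ∀ s, MeasurableSet s → ‖P s‖ₑ ^ 2 = ν s) {s : ℕ → Set α} (hs : ∀ n, MeasurableSet (s n))
    (hd : Pairwise (Function.onFun Disjoint s)) : HasSum (fun n => P (s n)) (P (⋃ n, s n)) := by
  have hempty : P ∅ = 0 := by simpa using hν ∅ MeasurableSet.empty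
  have hedist : ∀ F : Finset ℕ, edist (∑ n ∈ F, P (s n)) (P (⋃ n, s n)) ^ 2 =
      ∑' n : {n // n ∉ F}, ν (s n) := fun F => by
    have hsF : MeasurableSet (⋃ n ∈ F, s n) := Finset.measurableSet_biUnion _ fun n _ => hs n
    have hsF' : MeasurableSet (⋃ n : {n // n ∉ F}, s n) := MeasurableSet.iUnion fun n => hs n
    have hunion : (⋃ n ∈ F, s n) ∪ ⋃ n : {n // n ∉ F}, s n = ⋃ n, s n := by
      ext x
      simp only [mem_union, mem_iUnion, Subtype.exists, exists_prop, ← exists_or, ← or_and_right,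
        em, true_and]
    have hdisj : Disjoint (⋃ n ∈ F, s n) (⋃ n : {n // n ∉ F}, s n) :=
      disjoint_iUnion₂_left.2 fun n hn => disjoint_iUnion_right.2 fun k =>
        hd (ne_of_mem_of_not_mem hn k.2)
    rw [← hP.map_iUnion_fin_meas_set_eq_sum P hempty s F hs (fun _ _ => measure_ne_top _ _)
        (fun i _ j _ hij => hd hij), ← hunion,
      hP _ _ hsF hsF' (measure_ne_top _ _) (measure_ne_top _ _) hdisj, edist_comm,
      edist_eq_enorm_sub, add_sub_cancel_left, hν _ hsF']
    exact measure_iUnion (fun i j hij => hd fun h => hij (Subtype.ext h)) fun n => hs n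
  have hlim : Tendsto (fun F : Finset ℕ => edist (∑ n ∈ F, P (s n)) (P (⋃ n, s n)) ^ 2) atTop
      (𝓝 0) := by
    simp only [hedist]
    refine ENNReal.tendsto_tsum_compl_atTop_zero (f := fun n => ν (s n)) ?_
    rw [← measure_iUnion hd hs]
    exact measure_ne_top _ _
  have hsqrt := (ENNReal.continuous_rpow_const (y := 1 / 2)).tendsto 0 |>.comp hlim
  simp only [Function.comp_def, ← ENNReal.rpow_natCast, ← ENNReal.rpow_mul] at hsqrt
  rw [HasSum, SummationFilter.unconditional_filter, tendsto_iff_edist_tendsto_0]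
  simpa using hsqrt

section Multiplication

variable {α : Type*} [MeasurableSpace α] {μ : Measure α}

open Classical in
/-- Multiplication by the indicator function of a measurable set on `L²(μ)`; the value on a set
that is not measurable is `0`. -/
noncomputable def indicatorCLM (μ : Measure α) (s : Set α) : Lp ℂ 2 μ →L[ℂ] Lp ℂ 2 μ :=
  if hs : MeasurableSet s then
    LinearMap.mkContinuous
      { toFun := fun f => ((Lp.memLp f).indicator hs).toLp (s.indicator f)
        map_add' := fun f g => by
          rw [← MemLp.toLp_add, MemLp.toLp_eq_toLp_iff, ← indicator_add']
          exact (Lp.coeFn_add f g).indicator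
        map_smul' := fun a f => by
          rw [RingHom.id_apply, ← MemLp.toLp_const_smul, MemLp.toLp_eq_toLp_iff]
          exact (Lp.coeFn_smul a f).indicator.trans
            (Eventually.of_forall (indicator_const_smul_apply s a f)) }
      1 fun f => by
        rw [one_mul]
        refine Lp.norm_le_norm_of_ae_le ?_
        filter_upwards [((Lp.memLp f).indicator hs).coeFn_toLp] with t ht
        exact (congrArg norm ht).trans_le (norm_indicator_le_norm_self _ _)
  else 0

theorem coeFn_indicatorCLM {s : Set α} (hs : MeasurableSet s) (f : Lp ℂ 2 μ) :
    indicatorCLM μ s f =ᵐ[μ] s.indicator f := by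
  rw [indicatorCLM, dif_pos hs]
  exact ((Lp.memLp f).indicator hs).coeFn_toLp

theorem indicatorCLM_univ : indicatorCLM μ univ = 1 := by
  ext1 f
  refine Lp.ext ((coeFn_indicatorCLM MeasurableSet.univ f).trans ?_)
  rw [indicator_univ, one_apply_eq_self]

theorem indicatorCLM_inter {s t : Set α} (hs : MeasurableSet s) (ht : MeasurableSet t) :
    indicatorCLM μ (s ∩ t) = indicatorCLM μ s * indicatorCLM μ t := by
  ext1 f
  refine Lp.ext ((coeFn_indicatorCLM (hs.inter ht) f).trans ?_)
  rw [mul_apply_eq_comp, ← indicator_indicator]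
  exact ((coeFn_indicatorCLM hs _).trans (coeFn_indicatorCLM ht f).indicator).symm

theorem indicatorCLM_union {s t : Set α} (hs : MeasurableSet s) (ht : MeasurableSet t)
    (hst : Disjoint s t) : indicatorCLM μ (s ∪ t) = indicatorCLM μ s + indicatorCLM μ t := by
  ext1 f
  refine Lp.ext ((coeFn_indicatorCLM (hs.union ht) f).trans ?_)
  rw [indicator_union_of_disjoint hst]
  exact (((Lp.coeFn_add _ _).trans
    ((coeFn_indicatorCLM hs f).add (coeFn_indicatorCLM ht f)))).symm

theorem isStarProjection_indicatorCLM {s : Set α} (hs : MeasurableSet s) :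
    IsStarProjection (indicatorCLM μ s) := by
  refine ⟨?_, ContinuousLinearMap.isSelfAdjoint_iff_isSymmetric.2 fun f g => ?_⟩
  · rw [IsIdempotentElem, ← indicatorCLM_inter hs hs, inter_self]
  · change inner ℂ (indicatorCLM μ s f) g = inner ℂ f (indicatorCLM μ s g)
    rw [L2.inner_def, L2.inner_def]
    refine integral_congr_ae ?_
    filter_upwards [coeFn_indicatorCLM hs f, coeFn_indicatorCLM hs g] with x hf hg
    by_cases hx : x ∈ s <;> simp [hf, hg, hx]

theorem enorm_indicatorCLM_sq {s : Set α} (hs : MeasurableSet s) (f : Lp ℂ 2 μ) :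
    ‖indicatorCLM μ s f‖ₑ ^ 2 = μ.withDensity (fun x => ‖f x‖ₑ ^ 2) s := by
  rw [Lp.enorm_def, eLpNorm_congr_ae (coeFn_indicatorCLM hs f),
    eLpNorm_indicator_eq_eLpNorm_restrict hs, eLpNorm_two_sq, withDensity_apply _ hs]

theorem isFiniteMeasure_withDensity_enorm_sq (f : Lp ℂ 2 μ) :
    IsFiniteMeasure (μ.withDensity fun x => ‖f x‖ₑ ^ 2) :=
  ⟨by
    rw [← enorm_indicatorCLM_sq MeasurableSet.univ]
    exact ENNReal.pow_lt_top enorm_lt_top⟩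

theorem hasSum_indicatorCLM {s : ℕ → Set α} (hs : ∀ n, MeasurableSet (s n))
    (hd : Pairwise (Function.onFun Disjoint s)) (f : Lp ℂ 2 μ) :
    HasSum (fun n => indicatorCLM μ (s n) f) (indicatorCLM μ (⋃ n, s n) f) :=
  have := isFiniteMeasure_withDensity_enorm_sq f
  hasSum_of_enorm_sq_eq_measure (P := fun s => indicatorCLM μ s f)
    (fun s t hs ht _ _ hst => by simp only [indicatorCLM_union hs ht hst, _root_.add_apply])
    (fun s hs => enorm_indicatorCLM_sq hs f) hs hd

theorem indicatorCLM_eq_zero_iff [SigmaFinite μ] {s : Set α} (hs : MeasurableSet s) :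
    indicatorCLM μ s = 0 ↔ μ s = 0 := by
  constructor
  · intro h
    refine (Measure.forall_measure_inter_isCountablySpanning_eq_zero
      (isCountablySpanning_spanningSets μ)).1 (forall_mem_range.2 fun n => ?_)
    have hS := measurableSet_spanningSets μ n
    have hμS := (measure_spanningSets_lt_top μ n).ne
    have hzero : ‖indicatorCLM μ s (indicatorConstLp 2 hS hμS 1)‖ₑ ^ 2 = 0 := by simp [h]
    rw [Lp.enorm_def, eLpNorm_congr_ae ((coeFn_indicatorCLM hs _).trans
      indicatorConstLp_coeFn.indicator), indicator_indicator] at hzero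
    simpa [eLpNorm_indicator_const (hs.inter hS), not_lt_of_ge zero_le_two] using hzero
  · intro h
    ext1 f
    refine Lp.ext ((coeFn_indicatorCLM hs f).trans ?_)
    exact (indicator_meas_zero h).trans (Lp.coeFn_zero _ _ _).symm

theorem memLp_indicator_norm_le_mul {m f : α → ℂ} (hm : Measurable m) (hf : MemLp f 2 μ) (C : ℝ) :
    MemLp ({ξ | ‖m ξ‖ ≤ C}.indicator fun ξ => m ξ * f ξ) 2 μ := by
  refine hf.of_le_mul (c := max C 0) ((hm.aestronglyMeasurable.mul hf.1).indicator
    (measurableSet_le hm.norm measurable_const)) (Eventually.of_forall fun ξ => ?_)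
  rw [norm_indicator_eq_indicator_norm]
  refine indicator_apply_le' (fun hξ => ?_) fun _ => by positivity
  rw [norm_mul]
  gcongr
  exact le_max_of_le_left hξ

theorem ae_eq_mul_of_forall_inner_eq {m : α → ℂ} (hm : Measurable m) {g h : Lp ℂ 2 μ}
    (hgh : ∀ u v : Lp ℂ 2 μ, v =ᵐ[μ] (fun ξ => starRingEnd ℂ (m ξ) * u ξ) →
      inner ℂ v g = inner ℂ u h) : h =ᵐ[μ] fun ξ => m ξ * g ξ := by
  have hlevel : ∀ n : ℕ, ∀ᵐ ξ ∂μ, ‖m ξ‖ ≤ n → h ξ = m ξ * g ξ := fun n => by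
    have hS : MeasurableSet {ξ | ‖m ξ‖ ≤ n} := measurableSet_le hm.norm measurable_const
    have hmg := memLp_indicator_norm_le_mul hm (Lp.memLp g) n
    have heq : indicatorCLM μ {ξ | ‖m ξ‖ ≤ n} h = hmg.toLp _ := by
      refine ext_inner_left ℂ fun w => ?_
      have hmw := memLp_indicator_norm_le_mul (m := fun ξ => starRingEnd ℂ (m ξ))
        (continuous_star.measurable.comp hm) (Lp.memLp w) n
      simp only [RCLike.norm_conj] at hmw
      have hw := coeFn_indicatorCLM hS w
      calc inner ℂ w (indicatorCLM μ {ξ | ‖m ξ‖ ≤ n} h)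
          = inner ℂ (indicatorCLM μ {ξ | ‖m ξ‖ ≤ n} w) h := by
            simp only [L2.inner_def]
            refine integral_congr_ae ?_
            filter_upwards [coeFn_indicatorCLM hS h, hw] with ξ hh hw
            by_cases hξ : ξ ∈ {ξ | ‖m ξ‖ ≤ n} <;> simp [hh, hw, hξ]
        _ = inner ℂ (hmw.toLp _) g := by
            refine (hgh _ _ ?_).symm
            filter_upwards [hmw.coeFn_toLp, hw] with ξ hv hw
            rw [hv, hw, indicator_mul_right]
        _ = inner ℂ w (hmg.toLp _) := by
            simp only [L2.inner_def]
            refine integral_congr_ae ?_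
            filter_upwards [hmg.coeFn_toLp, hmw.coeFn_toLp] with ξ hg hv
            rw [hg, hv]
            by_cases hξ : ξ ∈ {ξ | ‖m ξ‖ ≤ n}
            · simp only [indicator_of_mem hξ, RCLike.inner_apply, map_mul, RCLike.conj_conj]
              ring
            · simp only [indicator_of_notMem hξ, inner_zero_left, inner_zero_right]
    filter_upwards [coeFn_indicatorCLM hS h, hmg.coeFn_toLp] with ξ hh hg hξ
    have hξS : ξ ∈ {ξ | ‖m ξ‖ ≤ n} := hξ
    rw [heq, hg, indicator_of_mem hξS, indicator_of_mem hξS] at hh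
    exact hh.symm
  filter_upwards [ae_all_iff.2 hlevel] with ξ hξ
  exact hξ ⌈‖m ξ‖⌉₊ (Nat.le_ceil _)

variable {H : Type*} [NormedAddCommGroup H] [InnerProductSpace ℂ H] [CompleteSpace H]

/-- The resolution of the identity of the operator that a unitary map `U` onto `L²(μ)` turns into
multiplication by `m`. -/
noncomputable def multiplicationResolution (U : H ≃ₗᵢ[ℂ] Lp ℂ 2 μ) (m : α → ℂ)
    (hm : Measurable m) : ResolutionOfIdentity H where
  proj s := U.symm.conjStarAlgEquiv (indicatorCLM μ (m ⁻¹' s))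
  isStarProjection s hs := (isStarProjection_indicatorCLM (hm hs)).map _
  proj_univ := by rw [preimage_univ, indicatorCLM_univ, map_one]
  proj_inter s t hs ht := by rw [preimage_inter, indicatorCLM_inter (hm hs) (hm ht), map_mul]
  hasSum_proj s hs hd x := by
    rw [preimage_iUnion]
    exact (hasSum_indicatorCLM (fun n => hm (hs n)) (fun i j hij => (hd hij).preimage m)
      (U x)).mapL (U.symm : Lp ℂ 2 μ →L[ℂ] H)

variable (U : H ≃ₗᵢ[ℂ] Lp ℂ 2 μ) {m : α → ℂ} (hm : Measurable m)

theorem scalarMeasure_multiplicationResolution (x : H) :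
    (multiplicationResolution U m hm).scalarMeasure x =
      (μ.withDensity fun ξ => ‖U x ξ‖ₑ ^ 2).map m := by
  refine Measure.ext fun s hs => ?_
  rw [ResolutionOfIdentity.scalarMeasure_apply_enorm _ _ hs, Measure.map_apply hm hs,
    ← enorm_indicatorCLM_sq (hm hs)]
  exact congrArg (· ^ 2) (U.symm.enorm_map _)

theorem multiplicationResolution_proj_eq_zero_iff [SigmaFinite μ] {s : Set ℂ}
    (hs : MeasurableSet s) :
    (multiplicationResolution U m hm).proj s = 0 ↔ μ (m ⁻¹' s) = 0 := by
  rw [← indicatorCLM_eq_zero_iff (hm hs)]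
  exact map_eq_zero_iff _ U.symm.conjStarAlgEquiv.injective

theorem isIntegral_id_multiplicationResolution {A : H →ₗ.[ℂ] H}
    (hA : ∀ x y, (x, y) ∈ A.graph ↔ U y =ᵐ[μ] fun ξ => m ξ * U x ξ) :
    (multiplicationResolution U m hm).IsIntegral id A := by
  have hU : ∀ x, Measurable fun ξ => ‖U x ξ‖₊ ^ 2 := fun x =>
    (Lp.stronglyMeasurable _).measurable.nnnorm.pow_const 2
  have hdensity : ∀ x, (fun ξ => ‖U x ξ‖ₑ ^ 2) = fun ξ => ((‖U x ξ‖₊ ^ 2 : NNReal) : ENNReal) :=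
    fun x => by simp [enorm]
  refine ⟨measurable_id, fun x => ?_, fun x => ?_⟩
  · have hUe : Measurable fun ξ => ‖U x ξ‖ₑ ^ 2 := hdensity x ▸ (hU x).coe_nnreal_ennreal
    have hint : ∫⁻ z, ‖id z‖ₑ ^ 2 ∂((multiplicationResolution U m hm).scalarMeasure x) =
        eLpNorm (fun ξ => m ξ * U x ξ) 2 μ ^ 2 := by
      rw [scalarMeasure_multiplicationResolution, lintegral_map (by fun_prop) hm,
        lintegral_withDensity_eq_lintegral_mul _ hUe (by fun_prop),
        eLpNorm_two_sq]
      simp only [Pi.mul_apply, enorm_mul, mul_pow, id, mul_comm]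
    rw [hint, LinearPMap.mem_domain_iff]
    constructor
    · rintro ⟨y, hy⟩
      rw [← eLpNorm_congr_ae ((hA x y).1 hy)]
      exact ENNReal.pow_lt_top (Lp.memLp (U y)).2
    · intro h
      have hmem : MemLp (fun ξ => m ξ * U x ξ) 2 μ :=
        ⟨hm.aestronglyMeasurable.mul (Lp.aestronglyMeasurable _), by simpa using h⟩
      refine ⟨U.symm (hmem.toLp _), (hA _ _).2 ?_⟩
      rw [U.apply_symm_apply]
      exact hmem.coeFn_toLp
  · rw [scalarMeasure_multiplicationResolution,
      integral_map hm.aemeasurable measurable_id.aestronglyMeasurable, hdensity,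
      integral_withDensity_eq_integral_smul (hU x), ← U.inner_map_map, L2.inner_def]
    refine integral_congr_ae (((hA x (A x)).1 (A.mem_graph x)).mono fun ξ hξ => ?_)
    simp only [hξ, RCLike.inner_apply, NNReal.smul_def]
    rw [mul_assoc, RCLike.mul_conj]
    simp [mul_comm]

end Multiplication

/-! ### Locally absolutely continuous functions -/

theorem absolutelyContinuousOnInterval_of_dist_le {X Y : Type*} [PseudoMetricSpace X]
    [PseudoMetricSpace Y] {f : ℝ → X} {g : ℝ → Y} {a b : ℝ}
    (hg : AbsolutelyContinuousOnInterval g a b)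
    (hfg : ∀ x ∈ uIcc a b, ∀ y ∈ uIcc a b, dist (f x) (f y) ≤ dist (g x) (g y)) :
    AbsolutelyContinuousOnInterval f a b := by
  rw [absolutelyContinuousOnInterval_iff] at hg ⊢
  intro ε hε
  obtain ⟨δ, hδ, h⟩ := hg ε hε
  refine ⟨δ, hδ, fun I hI hlt => (Finset.sum_le_sum fun i hi => ?_).trans_lt (h I hI hlt)⟩
  exact hfg _ (hI.1 i hi).1 _ (hI.1 i hi).2

theorem LocallyAC.mul {f g : ℝ → ℂ} (hf : LocallyAC f) (hg : LocallyAC g) :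
    LocallyAC (fun t => f t * g t) := fun a b => (hf a b).smul (hg a b)

theorem LocallyAC.conj {f : ℝ → ℂ} (hf : LocallyAC f) :
    LocallyAC (fun t => starRingEnd ℂ (f t)) := fun a b =>
  absolutelyContinuousOnInterval_of_dist_le (hf a b) fun _ _ _ _ => (Complex.dist_conj_conj _ _).le

theorem intervalIntegrable_of_locallyIntegrable {F : Type*} [NormedAddCommGroup F] {h : ℝ → F}
    (hh : LocallyIntegrable h) (a b : ℝ) : IntervalIntegrable h volume a b :=
  intervalIntegrable_iff.2 ((hh.integrableOn_isCompact isCompact_uIcc).mono_set uIoc_subset_uIcc)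

theorem locallyAC_of_sub_eq_integral {g h : ℝ → ℂ} (hh : LocallyIntegrable h)
    (hg : ∀ a b, g b - g a = ∫ s in a..b, h s) : LocallyAC g := fun a b => by
  have hi : ∀ x y, IntervalIntegrable (fun s => ‖h s‖) volume x y :=
    fun x y => (intervalIntegrable_of_locallyIntegrable hh x y).norm
  refine absolutelyContinuousOnInterval_of_dist_le
    ((hi a b).absolutelyContinuousOnInterval_intervalIntegral left_mem_uIcc) fun x _ y _ => ?_
  rw [dist_comm, dist_comm (∫ s in a..x, ‖h s‖), dist_eq_norm, dist_eq_norm, hg x y,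
    intervalIntegral.integral_interval_sub_left (hi _ _) (hi _ _)]
  exact intervalIntegral.norm_integral_le_abs_integral_norm

theorem ae_hasDerivAt_of_sub_eq_integral {F : Type*} [NormedAddCommGroup F] [NormedSpace ℝ F]
    [CompleteSpace F] {g h : ℝ → F} (hh : LocallyIntegrable h)
    (hg : ∀ a b, g b - g a = ∫ s in a..b, h s) : ∀ᵐ t, HasDerivAt g (h t) t := by
  have hprimitive : g = fun t => g 0 + ∫ s in (0 : ℝ)..t, h s :=
    funext fun t => by rw [← hg 0 t, add_sub_cancel]
  filter_upwards [LocallyIntegrable.ae_hasDerivAt_integral hh] with t ht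
  rw [hprimitive]
  exact (ht 0).const_add _

theorem LocallyAC.sub_eq_integral {g h : ℝ → ℂ} (hg : LocallyAC g) (hh : LocallyIntegrable h)
    (hd : ∀ᵐ t, HasDerivAt g (h t) t) (a b : ℝ) : g b - g a = ∫ s in a..b, h s := by
  have hi := intervalIntegrable_of_locallyIntegrable hh
  have hprimitive : LocallyAC fun t => ∫ s in a..t, h s :=
    locallyAC_of_sub_eq_integral hh fun x y =>
      intervalIntegral.integral_interval_sub_left (hi _ _) (hi _ _)
  obtain ⟨C, hC⟩ := ((hg a b).sub (hprimitive a b)).const_of_ae_hasDerivAt_zero (by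
    filter_upwards [hd, LocallyIntegrable.ae_hasDerivAt_integral hh] with t hgt hht _
    simpa using hgt.sub (hht a))
  have ha := hC a left_mem_uIcc
  have hb := hC b right_mem_uIcc
  simp only [Pi.sub_apply, intervalIntegral.integral_same, sub_zero] at ha hb
  rw [ha, ← hb, sub_sub_cancel]

theorem LocallyAC.integral_deriv_eq_zero {g h : ℝ → ℂ} (hg : LocallyAC g) (hgi : Integrable g)
    (hh : Integrable h) (hd : ∀ᵐ t, HasDerivAt g (h t) t) : ∫ t, h t = 0 := by
  have hlim : Tendsto (fun t => g t - g (-t)) atTop (𝓝 (∫ t, h t)) :=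
    (intervalIntegral_tendsto_integral hh tendsto_neg_atTop_atBot tendsto_id).congr fun t =>
      (hg.sub_eq_integral hh.locallyIntegrable hd (-t) t).symm
  refine ((hgi.sub hgi.comp_neg).integrableAtFilter atTop).eq_zero_of_tendsto (fun s hs => ?_) hlim
  obtain ⟨b, hb⟩ := mem_atTop_sets.1 hs
  exact measure_mono_top (s₁ := Ici b) hb Real.volume_Ici

local notation "L²ℝ" => Lp ℂ 2 (volume : Measure ℝ)

/-- `h` is the derivative of a locally absolutely continuous representative of `g`: the graph of
the derivative on `L²(ℝ)`. -/
def HasL2Deriv (g h : L²ℝ) : Prop :=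
  ∃ G : ℝ → ℂ, LocallyAC G ∧ g =ᵐ[volume] G ∧ ∀ᵐ t, HasDerivAt G (h t) t

theorem HasL2Deriv.inner_add_inner_eq_zero {u v g h : L²ℝ}
    (huv : HasL2Deriv u v) (hgh : HasL2Deriv g h) : inner ℂ v g + inner ℂ u h = 0 := by
  obtain ⟨U, hU, huU, hU'⟩ := huv
  obtain ⟨G, hG, hgG, hG'⟩ := hgh
  have hvg := L2.integrable_inner (𝕜 := ℂ) v g
  have huh := L2.integrable_inner (𝕜 := ℂ) u h
  rw [L2.inner_def, L2.inner_def, ← integral_add hvg huh]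
  refine (hU.conj.mul hG).integral_deriv_eq_zero ?_ (hvg.add huh) ?_
  · refine (L2.integrable_inner (𝕜 := ℂ) u g).congr ?_
    filter_upwards [huU, hgG] with t hut hgt
    rw [← hut, ← hgt, RCLike.inner_apply, mul_comm]
  · filter_upwards [huU, hgG, hU', hG'] with t hut hgt hU' hG'
    have hconj : HasDerivAt (fun t => starRingEnd ℂ (U t)) (starRingEnd ℂ (v t)) t := hU'.star
    refine (hconj.mul hG').congr_deriv ?_
    rw [RCLike.inner_apply, RCLike.inner_apply, hut, hgt]
    ring

/-! ### The Fourier transform of the derivative -/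

section FourierTransform

open FourierTransform SchwartzMap
open scoped ContDiff

section

variable {E F : Type*} [NormedAddCommGroup E] [InnerProductSpace ℝ E] [FiniteDimensional ℝ E]
  [MeasurableSpace E] [BorelSpace E] [NormedAddCommGroup F] [InnerProductSpace ℂ F]
  [CompleteSpace F]

theorem ae_eq_of_forall_integral_schwartz_smul_eq {f g : E → F} (hf : LocallyIntegrable f)
    (hg : LocallyIntegrable g) (hfg : ∀ ψ : 𝓢(E, ℂ), ∫ x, ψ x • f x = ∫ x, ψ x • g x) :
    f =ᵐ[volume] g := by
  refine ae_eq_of_integral_contDiff_smul_eq hf hg fun u u_smooth u_cpt => ?_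
  have hu_cpt : HasCompactSupport (Complex.ofRealCLM ∘ u) := u_cpt.comp_left rfl
  have hu_smooth : ContDiff ℝ ∞ (Complex.ofRealCLM ∘ u) := by fun_prop
  simpa using hfg (hu_cpt.toSchwartzMap hu_smooth)

theorem coeFn_fourier (f : Lp (α := E) F 2) (hf : Integrable f) :
    (𝓕 f : Lp (α := E) F 2) =ᵐ[volume] 𝓕 (f : E → F) := by
  have hcont : Continuous (𝓕 (f : E → F)) :=
    VectorFourier.fourierIntegral_continuous Real.continuous_fourierChar continuous_inner hf
  refine ae_eq_of_forall_integral_schwartz_smul_eq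
    ((Lp.memLp _).locallyIntegrable one_le_two) hcont.locallyIntegrable fun ψ => ?_
  have hdistr := congrArg (fun T : 𝓢'(E, F) => T ψ) (Lp.fourier_toTemperedDistribution_eq f)
  simp only [TemperedDistribution.fourier_apply, Lp.toTemperedDistribution_apply] at hdistr
  rw [← hdistr]
  simpa using! VectorFourier.integral_fourierIntegral_smul_eq_flip (L := innerₗ E)
    Real.continuous_fourierChar continuous_inner ψ.integrable hf

theorem coeFn_fourierInv (f : Lp (α := E) F 2) (hf : Integrable f) :
    (𝓕⁻ f : Lp (α := E) F 2) =ᵐ[volume] 𝓕⁻ (f : E → F) := by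
  have hinner : Continuous fun p : E × E => (-innerₗ E) p.1 p.2 := by
    simp only [LinearMap.neg_apply, innerₗ_apply_apply]
    fun_prop
  have hcont : Continuous (𝓕⁻ (f : E → F)) :=
    VectorFourier.fourierIntegral_continuous (L := -innerₗ E) Real.continuous_fourierChar hinner hf
  refine ae_eq_of_forall_integral_schwartz_smul_eq
    ((Lp.memLp _).locallyIntegrable one_le_two) hcont.locallyIntegrable fun ψ => ?_
  have hdistr := congrArg (fun T : 𝓢'(E, F) => T ψ) (Lp.fourierInv_toTemperedDistribution_eq f)
  simp only [TemperedDistribution.fourierInv_apply, Lp.toTemperedDistribution_apply] at hdistr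
  rw [← hdistr, fourierInv_coe]
  have hflip : (-innerₗ E).flip = -innerₗ E := by
    ext x y
    simp [real_inner_comm]
  have := VectorFourier.integral_fourierIntegral_smul_eq_flip (L := -innerₗ E)
    Real.continuous_fourierChar hinner (ψ.integrable (μ := volume)) hf
  rwa [hflip] at this

end

/-- The symbol `2πiξ` of the derivative. -/
noncomputable def derivSymbol (ξ : ℝ) : ℂ := 2 * Real.pi * Complex.I * ξ

theorem continuous_derivSymbol : Continuous derivSymbol := by
  unfold derivSymbol
  fun_prop

theorem norm_derivSymbol (ξ : ℝ) : ‖derivSymbol ξ‖ = 2 * Real.pi * |ξ| := by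
  simp [derivSymbol, abs_of_pos Real.pi_pos]

theorem conj_derivSymbol (ξ : ℝ) : starRingEnd ℂ (derivSymbol ξ) = -derivSymbol ξ := by
  simp [derivSymbol, Complex.conj_ofNat]

theorem norm_exp_derivSymbol_mul (ξ t : ℝ) : ‖Complex.exp (derivSymbol ξ * t)‖ = 1 := by
  simp [Complex.norm_exp, derivSymbol]

theorem integrable_of_memLp_derivSymbol_mul {f : ℝ → ℂ} (hf : MemLp f 2 volume)
    (hf' : MemLp (fun ξ => derivSymbol ξ * f ξ) 2 volume) : Integrable f := by
  have hsq := (memLp_two_iff_integrable_sq_norm hf.1).1 hf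
  have hsq' := (memLp_two_iff_integrable_sq_norm hf'.1).1 hf'
  refine ((integrable_inv_one_add_sq.add hsq).add hsq').mono' hf.1
    (Eventually.of_forall fun ξ => ?_)
  -- AM-GM: `2 ‖f‖ ≤ (1 + ξ²)⁻¹ + (1 + ξ²) ‖f‖²`
  have hamgm := two_mul_le_add_sq ((√(1 + ξ ^ 2))⁻¹) (√(1 + ξ ^ 2) * ‖f ξ‖)
  have hsqrt : (√(1 + ξ ^ 2)) ^ 2 = 1 + ξ ^ 2 := Real.sq_sqrt (by positivity)
  rw [mul_assoc, inv_mul_cancel_left₀ (by positivity), mul_pow, inv_pow, hsqrt] at hamgm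
  have hpi : 1 ≤ (2 * Real.pi) ^ 2 := by nlinarith [Real.pi_gt_three]
  have hsymbol : ξ ^ 2 * ‖f ξ‖ ^ 2 ≤ (2 * Real.pi) ^ 2 * (ξ ^ 2 * ‖f ξ‖ ^ 2) :=
    le_mul_of_one_le_left (by positivity) hpi
  simp only [Pi.add_apply, norm_mul, norm_derivSymbol, mul_pow, sq_abs]
  linarith [norm_nonneg (f ξ)]

theorem derivSymbol_mul_conj_integral_exp (a b ξ : ℝ) :
    derivSymbol ξ * starRingEnd ℂ (∫ t in a..b, Complex.exp (-derivSymbol ξ * t)) =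
      Complex.exp (derivSymbol ξ * b) - Complex.exp (derivSymbol ξ * a) := by
  by_cases hξ : derivSymbol ξ = 0
  · simp [hξ]
  · rw [integral_exp_mul_complex (neg_ne_zero.2 hξ)]
    simp only [map_div₀, map_sub, map_neg, ← Complex.exp_conj, map_mul, conj_derivSymbol,
      Complex.conj_ofReal, neg_neg]
    field_simp

theorem fourierInv_eq_integral_exp (f : ℝ → ℂ) (t : ℝ) :
    𝓕⁻ f t = ∫ ξ, Complex.exp (derivSymbol ξ * t) * f ξ := by
  rw [Real.fourierInv_eq']
  congr with ξ
  rw [smul_eq_mul, derivSymbol, real_inner_comm]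
  congr 2
  simp
  ring

theorem fourier_indicator_Ioc {a b : ℝ} (hab : a ≤ b) (ξ : ℝ) :
    𝓕 ((Ioc a b).indicator fun _ => (1 : ℂ)) ξ =
      ∫ t in a..b, Complex.exp (-derivSymbol ξ * t) := by
  rw [Real.fourier_eq', intervalIntegral.integral_of_le hab,
    ← integral_indicator measurableSet_Ioc]
  congr with t
  by_cases ht : t ∈ Ioc a b
  · simp only [indicator_of_mem ht, smul_eq_mul, mul_one, derivSymbol]
    congr 1
    simp
    ring
  · simp [indicator_of_notMem ht]

theorem coeFn_fourier_indicatorConstLp_Ioc {a b : ℝ} (hab : a ≤ b) :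
    (𝓕 (indicatorConstLp 2 measurableSet_Ioc (measure_Ioc_lt_top (a := a) (b := b)).ne (1 : ℂ) :
      L²ℝ) : L²ℝ) =ᵐ[volume] fun ξ => ∫ t in a..b, Complex.exp (-derivSymbol ξ * t) := by
  set χ : L²ℝ := indicatorConstLp 2 measurableSet_Ioc measure_Ioc_lt_top.ne (1 : ℂ)
  have hχ : χ =ᵐ[volume] (Ioc a b).indicator fun _ => 1 := indicatorConstLp_coeFn
  have hχi : Integrable χ := ((integrable_indicator_iff measurableSet_Ioc).2
    (integrableOn_const (measure_Ioc_lt_top (a := a) (b := b)).ne)).congr hχ.symm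
  refine (coeFn_fourier χ hχi).trans (Eventually.of_forall fun ξ => ?_)
  rw [Real.fourier_congr_ae hχ, fourier_indicator_Ioc hab]

section

variable {g h : L²ℝ}

theorem fourierInv_sub_fourierInv_eq_integral (hi : Integrable (𝓕 g : L²ℝ))
    (hgh : (𝓕 h : L²ℝ) =ᵐ[volume]
      fun ξ => derivSymbol ξ * (𝓕 g : L²ℝ) ξ) {a b : ℝ} (hab : a ≤ b) :
    𝓕⁻ ((𝓕 g : L²ℝ) : ℝ → ℂ) b -
      𝓕⁻ ((𝓕 g : L²ℝ) : ℝ → ℂ) a = ∫ s in a..b, h s := by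
  have hexp : ∀ t : ℝ, Integrable fun ξ : ℝ =>
      Complex.exp (derivSymbol ξ * t) * (𝓕 g : L²ℝ) ξ := fun t =>
    hi.bdd_mul (c := 1) (Continuous.aestronglyMeasurable <| by
      have := continuous_derivSymbol
      fun_prop) (Eventually.of_forall fun ξ => (norm_exp_derivSymbol_mul ξ t).le)
  rw [intervalIntegral.integral_of_le hab, ← L2.inner_indicatorConstLp_one (𝕜 := ℂ)
    measurableSet_Ioc (measure_Ioc_lt_top (a := a) (b := b)).ne, ← Lp.inner_fourier_eq,
    L2.inner_def, fourierInv_eq_integral_exp, fourierInv_eq_integral_exp,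
    ← integral_sub (hexp b) (hexp a)]
  refine integral_congr_ae ?_
  filter_upwards [coeFn_fourier_indicatorConstLp_Ioc hab, hgh] with ξ hχ hh
  rw [hχ, hh, RCLike.inner_apply, ← sub_mul, ← derivSymbol_mul_conj_integral_exp]
  ring

theorem hasL2Deriv_of_fourier (hgh : (𝓕 h : L²ℝ) =ᵐ[volume]
    fun ξ => derivSymbol ξ * (𝓕 g : L²ℝ) ξ) : HasL2Deriv g h := by
  have hi : Integrable (𝓕 g : L²ℝ) :=
    integrable_of_memLp_derivSymbol_mul (Lp.memLp _) ((memLp_congr_ae hgh).1 (Lp.memLp _))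
  have hloc : LocallyIntegrable h := (Lp.memLp h).locallyIntegrable one_le_two
  have hprimitive : ∀ a b, 𝓕⁻ ((𝓕 g : L²ℝ) : ℝ → ℂ) b -
      𝓕⁻ ((𝓕 g : L²ℝ) : ℝ → ℂ) a = ∫ s in a..b, h s := fun a b => by
    rcases le_total a b with hab | hba
    · exact fourierInv_sub_fourierInv_eq_integral hi hgh hab
    · rw [intervalIntegral.integral_symm, ← fourierInv_sub_fourierInv_eq_integral hi hgh hba,
        neg_sub]
  refine ⟨_, locallyAC_of_sub_eq_integral hloc hprimitive, ?_,
    ae_hasDerivAt_of_sub_eq_integral hloc hprimitive⟩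
  have hinv := coeFn_fourierInv _ hi
  rwa [fourierInv_fourier_eq] at hinv

-- The derivative is skew-adjoint on the functions to which `hasL2Deriv_of_fourier` applies, and
-- these are enough to determine the Fourier transform of `h`.
theorem HasL2Deriv.fourier_ae_eq (hgh : HasL2Deriv g h) :
    (𝓕 h : L²ℝ) =ᵐ[volume]
      fun ξ => derivSymbol ξ * (𝓕 g : L²ℝ) ξ := by
  refine ae_eq_mul_of_forall_inner_eq continuous_derivSymbol.measurable fun u v huv => ?_
  have hderiv : HasL2Deriv (𝓕⁻ u) (𝓕⁻ (-v)) := by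
    refine hasL2Deriv_of_fourier ?_
    rw [fourier_fourierInv_eq, fourier_fourierInv_eq]
    filter_upwards [Lp.coeFn_neg v, huv] with ξ hneg hv
    rw [hneg, Pi.neg_apply, hv, conj_derivSymbol, neg_mul, neg_neg]
  have hzero := hderiv.inner_add_inner_eq_zero hgh
  rwa [← Lp.inner_fourier_eq, ← Lp.inner_fourier_eq (𝓕⁻ u), fourier_fourierInv_eq,
    fourier_fourierInv_eq, inner_neg_left, neg_add_eq_zero] at hzero

end

end FourierTransform

/-! ### Diagonalization of the momentum operator -/

theorem mem_affine_graph_iff {H : Type*} [NormedAddCommGroup H] [InnerProductSpace ℂ H]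
    {A : H →ₗ.[ℂ] H} {α β : ℂ} (hβ : β ≠ 0) {x y : H} :
    (x, y) ∈ (affine α β A).graph ↔ (x, β⁻¹ • (y - α • x)) ∈ A.graph := by
  have hsolve : ∀ z, α • x + β • z = y ↔ z = β⁻¹ • (y - α • x) := fun z => by
    rw [← eq_sub_iff_add_eq', eq_inv_smul_iff₀ hβ]
  rw [LinearPMap.mem_graph_iff, LinearPMap.mem_graph_iff]
  constructor
  · rintro ⟨u, rfl, hu⟩
    exact ⟨u, rfl, (hsolve _).1 hu⟩
  · rintro ⟨u, rfl, hu⟩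
    exact ⟨u, rfl, (hsolve _).2 hu⟩

variable (c : ℝ)

theorem ae_weightMeasure : ae (weightMeasure c) = ae volume :=
  le_antisymm (withDensity_absolutelyContinuous _ _).ae_le
    (volume_absolutelyContinuous_weightMeasure c).ae_le

theorem eLpNorm_exp_mul (f : ℝ → ℂ) :
    eLpNorm (fun t => (Real.exp (-c * t) : ℂ) * f t) 2 volume = eLpNorm f 2 (weightMeasure c) := by
  refine (ENNReal.pow_right_strictMono two_ne_zero).injective ?_
  rw [eLpNorm_two_sq, eLpNorm_two_sq, weightMeasure,
    lintegral_withDensity_eq_lintegral_mul_non_measurable _ (by fun_prop)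
      (Eventually.of_forall fun t => ENNReal.ofReal_lt_top)]
  congr with t
  have hweight : ‖(Real.exp (-c * t) : ℂ)‖ₑ ^ 2 = ENNReal.ofReal (Real.exp (-2 * c * t)) := by
    rw [← ofReal_norm, ← ENNReal.ofReal_pow (norm_nonneg _), Complex.norm_real, Real.norm_eq_abs,
      Real.abs_exp, ← Real.exp_nat_mul]
    congr 2
    push_cast
    ring
  rw [Pi.mul_apply, enorm_mul, mul_pow, hweight]

theorem continuous_exp_mul (a : ℝ) : Continuous fun t : ℝ => (Real.exp (a * t) : ℂ) := by
  fun_prop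

theorem memLp_exp_mul_iff {f : ℝ → ℂ} (hf : AEStronglyMeasurable f volume) :
    MemLp (fun t => (Real.exp (-c * t) : ℂ) * f t) 2 volume ↔ MemLp f 2 (weightMeasure c) := by
  rw [MemLp, MemLp, eLpNorm_exp_mul]
  exact and_congr_left' (iff_of_true ((continuous_exp_mul (-c)).aestronglyMeasurable.mul hf)
    (hf.mono_ac (withDensity_absolutelyContinuous _ _)))

theorem memLp_exp_mul (f : WeightedSpace c) :
    MemLp (fun t => (Real.exp (-c * t) : ℂ) * f t) 2 volume :=
  (memLp_exp_mul_iff c ((Lp.aestronglyMeasurable f).mono_ac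
    (volume_absolutelyContinuous_weightMeasure c))).2 (Lp.memLp f)

theorem exp_neg_mul_exp (t : ℝ) : (Real.exp (-c * t) : ℂ) * (Real.exp (c * t) : ℂ) = 1 := by
  rw [← Complex.ofReal_mul, ← Real.exp_add]
  simp

/-- The isometry `f ↦ e^{-ct} f` from the weighted space to `L²(ℝ)`. -/
noncomputable def weightIsometry : WeightedSpace c →ₗᵢ[ℂ] L²ℝ where
  toFun f := (memLp_exp_mul c f).toLp _
  map_add' f g := by
    rw [← MemLp.toLp_add]
    refine MemLp.toLp_congr _ _ ?_
    rw [EventuallyEq, ← ae_weightMeasure c]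
    filter_upwards [Lp.coeFn_add f g] with t ht
    rw [ht, Pi.add_apply, mul_add, Pi.add_apply]
  map_smul' a f := by
    rw [RingHom.id_apply, ← MemLp.toLp_const_smul]
    refine MemLp.toLp_congr _ _ ?_
    rw [EventuallyEq, ← ae_weightMeasure c]
    filter_upwards [Lp.coeFn_smul a f] with t ht
    rw [ht, Pi.smul_apply, mul_smul_comm, Pi.smul_apply]
  norm_map' f := by
    change ‖(memLp_exp_mul c f).toLp _‖ = _
    rw [Lp.norm_toLp, eLpNorm_exp_mul, Lp.norm_def]

theorem coeFn_weightIsometry (f : WeightedSpace c) :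
    weightIsometry c f =ᵐ[volume] fun t => (Real.exp (-c * t) : ℂ) * f t :=
  (memLp_exp_mul c f).coeFn_toLp

theorem weightIsometry_surjective : Function.Surjective (weightIsometry c) := fun g => by
  have hcancel : ∀ t, (Real.exp (-c * t) : ℂ) * ((Real.exp (c * t) : ℂ) * g t) = g t := fun t => by
    rw [← mul_assoc, exp_neg_mul_exp, one_mul]
  have hmem : MemLp (fun t => (Real.exp (c * t) : ℂ) * g t) 2 (weightMeasure c) := by
    refine (memLp_exp_mul_iff c ((continuous_exp_mul c).aestronglyMeasurable.mul
      (Lp.aestronglyMeasurable g))).1 ?_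
    simpa only [Pi.mul_apply, hcancel] using Lp.memLp g
  refine ⟨hmem.toLp _, Lp.ext ((coeFn_weightIsometry c _).trans ?_)⟩
  rw [EventuallyEq, ← ae_weightMeasure c]
  filter_upwards [hmem.coeFn_toLp] with t ht
  rw [ht, hcancel]

/-- The unitary map `f ↦ 𝓕 (e^{-ct} f)` that diagonalizes the momentum operator. -/
noncomputable def momentumUnitary : WeightedSpace c ≃ₗᵢ[ℂ] L²ℝ :=
  (LinearIsometryEquiv.ofSurjective (weightIsometry c) (weightIsometry_surjective c)).trans
    (Lp.fourierTransformₗᵢ ℝ ℂ)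

theorem hasDerivAt_exp_mul (a t : ℝ) :
    HasDerivAt (fun t : ℝ => (Real.exp (a * t) : ℂ)) (a * Real.exp (a * t)) t := by
  simpa [mul_comm] using ((hasDerivAt_id t).const_mul a).exp.ofReal_comp

theorem locallyAC_exp_mul (a : ℝ) : LocallyAC fun t => (Real.exp (a * t) : ℂ) := fun _ _ =>
  ContDiffOn.absolutelyContinuousOnInterval (Complex.ofRealCLM.contDiff.comp
    (by fun_prop : ContDiff ℝ 1 fun t => Real.exp (a * t))).contDiffOn

theorem mem_shiftGraph_iff (f h : WeightedSpace c) :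
    (f, h) ∈ shiftGraph c ↔
      HasL2Deriv (weightIsometry c f) (weightIsometry c h - (c : ℂ) • weightIsometry c f) := by
  have hWf := coeFn_weightIsometry c f
  have hW' : ∀ᵐ t, (weightIsometry c h - (c : ℂ) • weightIsometry c f : L²ℝ) t =
      (Real.exp (-c * t) : ℂ) * (h t - c * f t) := by
    filter_upwards [Lp.coeFn_sub (weightIsometry c h) ((c : ℂ) • weightIsometry c f),
      Lp.coeFn_smul (c : ℂ) (weightIsometry c f), hWf, coeFn_weightIsometry c h]
      with t hsub hsmul hf hh
    rw [hsub, Pi.sub_apply, hsmul, Pi.smul_apply, hf, hh, smul_eq_mul]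
    ring
  change (∃ g, LocallyAC g ∧ (∀ᵐ t ∂weightMeasure c, f t = g t) ∧
    ∀ᵐ t ∂weightMeasure c, HasDerivAt g (h t) t) ↔ _
  rw [ae_weightMeasure]
  constructor
  · rintro ⟨g, hg, hfg, hg'⟩
    refine ⟨_, (locallyAC_exp_mul (-c)).mul hg, ?_, ?_⟩
    · filter_upwards [hWf, hfg] with t hWt hft
      rw [hWt, hft]
    · filter_upwards [hW', hg', hfg] with t hWt hgt hft
      refine ((hasDerivAt_exp_mul (-c) t).mul hgt).congr_deriv ?_
      rw [hWt, hft]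
      push_cast
      ring
  · rintro ⟨g, hg, hfg, hg'⟩
    refine ⟨_, (locallyAC_exp_mul c).mul hg, ?_, ?_⟩
    · filter_upwards [hWf, hfg] with t hWt hft
      rw [← hft, hWt]
      linear_combination (-f t) * exp_neg_mul_exp c t
    · filter_upwards [hW', hg', hfg, hWf] with t hWt' hgt hft hWt
      refine ((hasDerivAt_exp_mul c t).mul hgt).congr_deriv ?_
      rw [← hft, hWt', hWt]
      linear_combination (h t) * exp_neg_mul_exp c t

theorem mem_momentum_graph_iff_hasL2Deriv (f k : WeightedSpace c) :
    (f, k) ∈ (momentum c).graph ↔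
      HasL2Deriv (weightIsometry c f) (Complex.I • weightIsometry c k) := by
  have hshift : (1 / Complex.I)⁻¹ • (k - (-(c : ℂ) / Complex.I) • f) =
      Complex.I • k + (c : ℂ) • f := by
    rw [smul_sub, smul_smul, inv_div, div_one, mul_div_cancel₀ _ Complex.I_ne_zero, neg_smul,
      sub_neg_eq_add]
  rw [momentum, mem_affine_graph_iff (one_div_ne_zero Complex.I_ne_zero), hshift, shift_graph,
    mem_shiftGraph_iff, map_add, map_smul, map_smul, add_sub_cancel_right]

/-- The symbol `2πξ` of the momentum operator. -/
noncomputable def momentumSymbol (ξ : ℝ) : ℂ := ((2 * Real.pi * ξ : ℝ) : ℂ)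

theorem measurable_momentumSymbol : Measurable momentumSymbol := by
  unfold momentumSymbol
  fun_prop

theorem derivSymbol_eq (ξ : ℝ) : derivSymbol ξ = Complex.I * momentumSymbol ξ := by
  rw [derivSymbol, momentumSymbol]
  push_cast
  ring

open FourierTransform in
theorem mem_momentum_graph_iff (f k : WeightedSpace c) :
    (f, k) ∈ (momentum c).graph ↔
      momentumUnitary c k =ᵐ[volume] fun ξ => momentumSymbol ξ * momentumUnitary c f ξ := by
  have hsymbol : (𝓕 (Complex.I • weightIsometry c k) : L²ℝ) =ᵐ[volume]
      (fun ξ => derivSymbol ξ * (𝓕 (weightIsometry c f) : L²ℝ) ξ) ↔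
      momentumUnitary c k =ᵐ[volume] fun ξ => momentumSymbol ξ * momentumUnitary c f ξ := by
    have hI : (𝓕 (Complex.I • weightIsometry c k) : L²ℝ) =ᵐ[volume]
        fun ξ => Complex.I * momentumUnitary c k ξ := by
      rw [FourierTransform.fourier_smul]
      exact Lp.coeFn_smul _ _
    refine eventually_congr (hI.mono fun ξ hξ => ?_)
    simp only [hξ, derivSymbol_eq, mul_assoc]
    exact mul_right_inj' Complex.I_ne_zero
  rw [mem_momentum_graph_iff_hasL2Deriv, ← hsymbol]
  exact ⟨HasL2Deriv.fourier_ae_eq, hasL2Deriv_of_fourier⟩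

/-- The resolution of the identity of the momentum operator. -/
noncomputable def momentumResolution : ResolutionOfIdentity (WeightedSpace c) :=
  multiplicationResolution (momentumUnitary c) momentumSymbol measurable_momentumSymbol

theorem isIntegral_momentumResolution : (momentumResolution c).IsIntegral id (momentum c) :=
  isIntegral_id_multiplicationResolution _ _ (mem_momentum_graph_iff c)

theorem momentumResolution_proj_eq_zero_iff {s : Set ℂ} (hs : MeasurableSet s) :
    (momentumResolution c).proj s = 0 ↔ volume {x : ℝ | (x : ℂ) ∈ s} = 0 := by
  have hpi : 2 * Real.pi ≠ 0 := by positivity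
  have hscale : momentumSymbol ⁻¹' s = (2 * Real.pi * ·) ⁻¹' {x : ℝ | (x : ℂ) ∈ s} := rfl
  rw [momentumResolution, multiplicationResolution_proj_eq_zero_iff _ _ hs, hscale,
    Real.volume_preimage_mul_left hpi]
  simp

/-! ### Zeros of meromorphic cut-off functions -/

theorem volume_setOf_eq_zero_of_meromorphicAt {φ : ℝ → ℝ} (hφ : Continuous φ) {x₀ : ℝ}
    (hx₀ : φ x₀ ≠ 0) {Φ : ℂ → ℂ} (hΦ : ∀ x : ℝ, MeromorphicAt Φ x) (hΦφ : ∀ x : ℝ, Φ x = φ x) :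
    volume {x | φ x = 0} = 0 := by
  have hcomp : Φ ∘ Complex.ofReal = fun x => (φ x : ℂ) := funext hΦφ
  have hanalytic : AnalyticOnNhd ℝ (fun x => (φ x : ℂ)) univ := fun x _ => by
    refine MeromorphicAt.analyticAt ?_ (Complex.continuous_ofReal.comp hφ).continuousAt
    rw [← hcomp]
    exact (hΦ x).comp_analyticAt (Complex.ofRealCLM.analyticAt x)
  have hae : ∀ᵐ x, (φ x : ℂ) ≠ 0 := by
    rw [← Measure.restrict_univ (μ := volume)]
    exact ae_restrict_le_codiscreteWithin MeasurableSet.univ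
      (hanalytic.preimage_zero_mem_codiscrete (Complex.ofReal_ne_zero.2 hx₀))
  simpa [ae_iff] using hae

theorem IsAdmissibleCutoff.volume_zeros {c T : ℝ} {φ : ℝ → ℝ} (hφ : IsAdmissibleCutoff c T φ)
    (hT : 0 < T) (hc : c = 1) : volume {x | φ x = 0} = 0 := by
  obtain ⟨hcont, hrange, hmero⟩ := hφ
  obtain ⟨U, Φ, -, hU, hΦ, hΦφ⟩ := hmero hc
  have hTrange : T ∈ closure (range φ) := hrange ▸ ⟨by linarith, le_rfl⟩
  obtain ⟨_, hpos, x₀, rfl⟩ := mem_closure_iff.1 hTrange (Ioi 0) isOpen_Ioi hT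
  exact volume_setOf_eq_zero_of_meromorphicAt hcont (ne_of_gt hpos) (fun x => hΦ x (hU x)) hΦφ

/-! ### The zeta function as a map into the Riemann sphere -/

theorem tendsto_norm_riemannZeta_one : Tendsto (fun s => ‖riemannZeta s‖) (𝓝[≠] 1) atTop := by
  have hsub : Tendsto (fun s : ℂ => s - 1) (𝓝[≠] 1) (𝓝[≠] 0) := by
    have hcont : ContinuousWithinAt (fun s : ℂ => s - 1) {1}ᶜ 1 := by fun_prop
    simpa using hcont.tendsto_nhdsWithin (t := {0}ᶜ) fun s hs => by simpa [sub_eq_zero] using hs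
  have hpole := (tendsto_norm_cobounded_atTop.comp (tendsto_inv₀_nhdsNE_zero (α := ℂ))).comp hsub
  have hres := riemannZeta_residue_one.norm
  rw [norm_one] at hres
  refine (hres.pos_mul_atTop one_pos hpole).congr' ?_
  filter_upwards [self_mem_nhdsWithin] with s hs
  rw [Function.comp_apply, Function.comp_apply, ← norm_mul, mul_right_comm,
    mul_inv_cancel₀ (sub_ne_zero.2 hs), one_mul]

theorem continuousAt_riemannZeta {s : ℂ} (hs : s ≠ 1) : ContinuousAt riemannZeta s :=
  (differentiableAt_riemannZeta hs).continuousAt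

theorem measurable_riemannZeta : Measurable riemannZeta :=
  measurable_of_continuousOn_compl_singleton 1 fun _ hs =>
    (continuousAt_riemannZeta hs).continuousWithinAt

theorem zetaSphere_one : zetaSphere 1 = OnePoint.infty :=
  if_pos rfl

theorem zetaSphere_of_ne_one {s : ℂ} (hs : s ≠ 1) : zetaSphere s = (riemannZeta s : OnePoint ℂ) :=
  if_neg hs

theorem continuous_zetaSphere : Continuous zetaSphere := by
  have hupdate : zetaSphere = Function.update (fun s => (riemannZeta s : OnePoint ℂ)) 1
      OnePoint.infty := funext fun s => by rw [Function.update_apply, zetaSphere]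
  rw [hupdate]
  refine continuous_iff_continuousAt.2 fun s => ?_
  rcases eq_or_ne s 1 with rfl | hs
  · refine continuousAt_update_same.2 (OnePoint.tendsto_coe_infty.comp ?_)
    rw [coclosedCompact_eq_cocompact, ← Metric.cobounded_eq_cocompact,
      ← tendsto_norm_atTop_iff_cobounded]
    exact tendsto_norm_riemannZeta_one
  · exact (continuousAt_update_of_ne hs).2
      (OnePoint.continuous_coe.continuousAt.comp (continuousAt_riemannZeta hs))

/-! ### Spectra as essential ranges -/

section ExtendedSpectrum

variable {H : Type*} [NormedAddCommGroup H] [InnerProductSpace ℂ H] {A : H →ₗ.[ℂ] H}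

theorem coe_mem_extendedSpectrum_iff {z : ℂ} :
    (z : OnePoint ℂ) ∈ extendedSpectrum A ↔ z ∈ spectrum A := by
  simp [extendedSpectrum]

theorem infty_mem_extendedSpectrum_iff :
    OnePoint.infty ∈ extendedSpectrum A ↔ ¬ IsBounded A := by
  simp [extendedSpectrum]

theorem isInvertible_iff_zero_notMem_spectrum : IsInvertible A ↔ 0 ∉ spectrum A := by
  simp [spectrum, affine]

end ExtendedSpectrum

namespace ResolutionOfIdentity

variable {H : Type*} [NormedAddCommGroup H] [InnerProductSpace ℂ H] [CompleteSpace H]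
  {E : ResolutionOfIdentity H} {f : ℂ → ℂ} {A : H →ₗ.[ℂ] H}

theorem IsIntegral.isNormal (h : E.IsIntegral f A) : IsNormal A := by
  rw [h.eq_integral]
  exact E.isNormal_integral h.1

theorem IsIntegral.isBounded_iff (h : E.IsIntegral f A) :
    IsBounded A ↔ ∃ C : ℝ, E.proj {w | C < ‖f w‖} = 0 := by
  rw [h.eq_integral]
  refine ⟨E.exists_proj_eq_zero_of_isBounded h.1, fun ⟨C, hC⟩ =>
    E.isBounded_integral h.1 (le_max_right C 0) ?_⟩
  exact E.proj_eq_zero_of_subset (measurableSet_lt_norm h.1 _) (measurableSet_lt_norm h.1 _)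
    (fun w hw => (le_max_left C 0).trans_lt hw) hC

theorem IsIntegral.domain_eq_top (h : E.IsIntegral f A) (hA : IsBounded A) : A.domain = ⊤ := by
  obtain ⟨C, hC⟩ := h.isBounded_iff.1 hA
  rw [h.eq_integral]
  exact E.integral_domain_eq_top h.1 hC

theorem IsIntegral.isInvertible_iff (h : E.IsIntegral f A) :
    IsInvertible A ↔ ∃ ε > 0, E.proj {w | ‖f w‖ < ε} = 0 := by
  rw [h.eq_integral]
  constructor
  · intro hinv
    obtain ⟨ε, hε, hnull⟩ := E.exists_proj_eq_zero_of_isInvertible h.1 hinv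
    exact ⟨ε, hε, E.proj_eq_zero_of_subset (measurableSet_lt h.1.norm measurable_const)
      (measurableSet_norm_le h.1 ε) (ofPred_subset_ofPred.2 fun _ => le_of_lt) hnull⟩
  · rintro ⟨ε, hε, hnull⟩
    exact E.isInvertible_integral h.1 hε hnull

theorem IsIntegral.mem_spectrum_iff (h : E.IsIntegral f A) {z : ℂ} :
    z ∈ spectrum A ↔ ∀ ε > 0, E.proj (f ⁻¹' Metric.ball z ε) ≠ 0 := by
  have hball : ∀ ε, {w | ‖-z + 1 * f w‖ < ε} = f ⁻¹' Metric.ball z ε := fun ε => by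
    ext w
    simp [dist_eq_norm, ← sub_eq_neg_add]
  rw [spectrum, mem_ofPred_eq, (h.affine (-z) one_ne_zero).isInvertible_iff]
  simp only [hball]
  push Not
  rfl

theorem IsIntegral.mem_extendedSpectrum_iff (h : E.IsIntegral f A) {w : OnePoint ℂ} :
    w ∈ extendedSpectrum A ↔
      ∀ U, IsOpen U → w ∈ U → E.proj {z | (f z : OnePoint ℂ) ∈ U} ≠ 0 := by
  have hmeas : ∀ U : Set (OnePoint ℂ), IsOpen U → MeasurableSet {z | (f z : OnePoint ℂ) ∈ U} :=
    fun U hU => h.1 (hU.preimage OnePoint.continuous_coe).measurableSet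
  induction w with
  | infty =>
    rw [infty_mem_extendedSpectrum_iff, h.isBounded_iff, not_exists]
    constructor
    · intro hunb U hU hwU hnull
      have hnhds : ((↑) : ℂ → OnePoint ℂ) ⁻¹' U ∈ coclosedCompact ℂ :=
        OnePoint.comap_coe_nhds_infty (X := ℂ) ▸ preimage_mem_comap (hU.mem_nhds hwU)
      rw [coclosedCompact_eq_cocompact, ← Metric.cobounded_eq_cocompact,
        ← comap_norm_atTop] at hnhds
      obtain ⟨C, -, hC⟩ := ((atTop_basis_Ioi (α := ℝ)).comap _).mem_iff.1 hnhds
      exact hunb C (E.proj_eq_zero_of_subset (measurableSet_lt_norm h.1 C) (hmeas U hU)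
        (fun w hw => hC hw) hnull)
    · intro hU C
      have hopen := OnePoint.isOpen_compl_image_coe.2
        ⟨Metric.isClosed_closedBall, isCompact_closedBall (0 : ℂ) C⟩
      simpa using hU _ hopen (by simp)
  | coe w =>
    rw [coe_mem_extendedSpectrum_iff, h.mem_spectrum_iff]
    constructor
    · intro hw U hU hwU hnull
      obtain ⟨ε, hε, hball⟩ := Metric.isOpen_iff.1 (hU.preimage OnePoint.continuous_coe) w hwU
      exact hw ε hε (E.proj_eq_zero_of_subset (h.1 Metric.isOpen_ball.measurableSet) (hmeas U hU)
        (fun z hz => hball hz) hnull)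
    · intro hw ε hε
      simpa [preimage] using hw _ (OnePoint.isOpen_image_coe.2 Metric.isOpen_ball)
        (mem_image_of_mem _ (Metric.mem_ball_self hε))

variable (E) in
/-- `K` is the support of `E`: `E` vanishes off `K`, but on no neighbourhood of a point of `K`. -/
def IsSupport (K : Set ℂ) : Prop :=
  E.proj Kᶜ = 0 ∧ ∀ z ∈ K, ∀ U, IsOpen U → z ∈ U → E.proj U ≠ 0

variable (E) in
theorem proj_eq_zero_of_subset_union {s t u : Set ℂ} (hs : MeasurableSet s) (ht : MeasurableSet t)
    (hu : MeasurableSet u) (hstu : s ⊆ t ∪ u) (ht₀ : E.proj t = 0) (hu₀ : E.proj u = 0) :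
    E.proj s = 0 :=
  (E.proj_eq_zero_iff hs).2 fun x => measure_mono_null hstu
    (measure_union_null ((E.proj_eq_zero_iff ht).1 ht₀ x) ((E.proj_eq_zero_iff hu).1 hu₀ x))

theorem IsIntegral.extendedSpectrum_eq_image (h : E.IsIntegral f A) {K N : Set ℂ}
    (hK : IsCompact K) (hE : E.IsSupport K) {F : ℂ → OnePoint ℂ} (hF : Continuous F)
    (hN : MeasurableSet N) (hN₀ : E.proj N = 0) (hFf : ∀ z ∉ N, F z = f z) :
    extendedSpectrum A = F '' K := by
  have hmeas : ∀ U : Set (OnePoint ℂ), IsOpen U → MeasurableSet {z | (f z : OnePoint ℂ) ∈ U} :=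
    fun U hU => h.1 (hU.preimage OnePoint.continuous_coe).measurableSet
  ext w
  rw [h.mem_extendedSpectrum_iff]
  constructor
  · intro hw
    by_contra hwK
    have hopen : IsOpen (F '' K)ᶜ := (hK.image hF).isClosed.isOpen_compl
    refine hw _ hopen hwK (E.proj_eq_zero_of_subset_union (hmeas _ hopen)
      hK.isClosed.measurableSet.compl hN (fun z hz => or_iff_not_imp_right.2 fun hzN hzK => ?_)
      hE.1 hN₀)
    exact hz ⟨z, hzK, hFf z hzN⟩
  · rintro ⟨z, hzK, rfl⟩ U hU hzU hnull
    refine hE.2 z hzK _ (hU.preimage hF) hzU (E.proj_eq_zero_of_subset_union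
      (hU.preimage hF).measurableSet (hmeas U hU) hN (fun y hy => ?_) hnull hN₀)
    refine or_iff_not_imp_right.2 fun hyN => ?_
    rw [mem_ofPred_eq, ← hFf y hyN]
    exact hy

end ResolutionOfIdentity

/-! ### The truncated spectral operator -/

/-- The segment `{s | Re s = c, |Im s| ≤ T}`. -/
def segment (c T : ℝ) : Set ℂ := {s | s.re = c ∧ |s.im| ≤ T}

theorem segment_eq_image (c T : ℝ) :
    segment c T = (fun τ : ℝ => (c + τ * Complex.I : ℂ)) '' Icc (-T) T := by
  ext s
  simp only [segment, mem_ofPred_eq, mem_image, mem_Icc, ← abs_le, Complex.ext_iff]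
  constructor
  · rintro ⟨rfl, hs⟩
    exact ⟨s.im, hs, by simp, by simp⟩
  · rintro ⟨τ, hτ, hre, him⟩
    simp_all

theorem isCompact_segment (c T : ℝ) : IsCompact (segment c T) := by
  rw [segment_eq_image]
  exact isCompact_Icc.image (by fun_prop)

theorem image_segment {β : Type*} (g : ℂ → β) (c T : ℝ) :
    g '' segment c T = {z | ∃ τ : ℝ, |τ| ≤ T ∧ z = g (c + τ * Complex.I)} := by
  ext z
  simp only [segment_eq_image, image_image, mem_image, mem_Icc, ← abs_le, mem_ofPred_eq, eq_comm]

section TruncatedShift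

variable (c : ℝ) {φ : ℝ → ℝ}

theorem measurable_shiftSymbol (hφ : Measurable φ) :
    Measurable fun z : ℂ => (c : ℂ) + Complex.I * (φ z.re : ℂ) := by
  fun_prop

/-- The resolution of the identity of `c + i φ(V_c)`. -/
noncomputable def shiftResolution (hφ : Measurable φ) : ResolutionOfIdentity (WeightedSpace c) :=
  (momentumResolution c).map _ (measurable_shiftSymbol c hφ)

theorem isIntegral_shiftResolution (hφ : Measurable φ) :
    (shiftResolution c hφ).IsIntegral id (truncatedShift c φ) :=
  (ResolutionOfIdentity.isIntegral_map_iff _ (measurable_shiftSymbol c hφ) measurable_id).2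
    ((ResolutionOfIdentity.isIntegral_functionalCalculus (isIntegral_momentumResolution c)
      (by fun_prop)).affine c Complex.I_ne_zero)

theorem isIntegral_truncatedSpectralOperator (hφ : Measurable φ) :
    (shiftResolution c hφ).IsIntegral riemannZeta (truncatedSpectralOperator c φ) :=
  ResolutionOfIdentity.isIntegral_functionalCalculus (isIntegral_shiftResolution c hφ)
    measurable_riemannZeta

theorem shiftResolution_proj_eq_zero_iff (hφ : Measurable φ) {s : Set ℂ} (hs : MeasurableSet s) :
    (shiftResolution c hφ).proj s = 0 ↔ volume {x | (c + Complex.I * φ x : ℂ) ∈ s} = 0 :=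
  momentumResolution_proj_eq_zero_iff c (measurable_shiftSymbol c hφ hs)

variable {c}

theorem isSupport_shiftResolution {T : ℝ} (hφ : Continuous φ)
    (hrange : closure (range φ) = Icc (-T) T) :
    (shiftResolution c hφ.measurable).IsSupport (segment c T) := by
  constructor
  · rw [shiftResolution_proj_eq_zero_iff c _ (isCompact_segment c T).measurableSet.compl]
    have hmem : ∀ x, (c + Complex.I * φ x : ℂ) ∈ segment c T := fun x => by
      have hx : φ x ∈ Icc (-T) T := hrange ▸ subset_closure (mem_range_self x)
      exact ⟨by simp, by simpa using abs_le.2 hx⟩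
    simp [hmem]
  · intro z hz U hU hzU hnull
    rw [shiftResolution_proj_eq_zero_iff c _ hU.measurableSet] at hnull
    rw [segment_eq_image, ← hrange] at hz
    obtain ⟨τ, hτ, rfl⟩ := hz
    have hopen : IsOpen ((fun y : ℝ => (c + Complex.I * y : ℂ)) ⁻¹' U) :=
      hU.preimage (by fun_prop)
    obtain ⟨_, hx, x, rfl⟩ := mem_closure_iff.1 hτ _ hopen (by simpa [mul_comm] using hzU)
    exact ((hopen.preimage hφ).measure_pos volume ⟨x, hx⟩).ne' hnull

theorem shiftResolution_proj_singleton_one (hφ : Measurable φ)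
    (hzeros : c = 1 → volume {x | φ x = 0} = 0) : (shiftResolution c hφ).proj {1} = 0 := by
  rw [shiftResolution_proj_eq_zero_iff c hφ (measurableSet_singleton 1)]
  have hiff : ∀ x, (c + Complex.I * φ x : ℂ) ∈ ({1} : Set ℂ) ↔ c = 1 ∧ φ x = 0 := fun x => by
    simp [Complex.ext_iff]
  simp only [hiff]
  by_cases hc : c = 1
  · simpa only [hc, true_and] using hzeros hc
  · simp [hc]

theorem extendedSpectrum_truncatedSpectralOperator {T : ℝ} (hφ : Continuous φ)
    (hrange : closure (range φ) = Icc (-T) T) (hzeros : c = 1 → volume {x | φ x = 0} = 0) :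
    extendedSpectrum (truncatedSpectralOperator c φ) = zetaSphere '' segment c T :=
  (isIntegral_truncatedSpectralOperator c hφ.measurable).extendedSpectrum_eq_image
    (isCompact_segment c T) (isSupport_shiftResolution hφ hrange) continuous_zetaSphere
    (measurableSet_singleton 1) (shiftResolution_proj_singleton_one hφ.measurable hzeros)
    fun _ => zetaSphere_of_ne_one

end TruncatedShift

theorem spectrum_eq_image_of_extendedSpectrum_eq {H : Type*} [NormedAddCommGroup H]
    [InnerProductSpace ℂ H] {A : H →ₗ.[ℂ] H} {K : Set ℂ} (hK : (1 : ℂ) ∉ K)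
    (h : extendedSpectrum A = zetaSphere '' K) : spectrum A = riemannZeta '' K := by
  have hcoe : zetaSphere '' K = ((↑) : ℂ → OnePoint ℂ) '' (riemannZeta '' K) := by
    rw [image_image]
    exact image_congr fun s hs => zetaSphere_of_ne_one (ne_of_mem_of_not_mem hs hK)
  ext z
  rw [← coe_mem_extendedSpectrum_iff, h, hcoe, OnePoint.coe_injective.mem_set_image]

theorem infty_mem_image_zetaSphere_iff {K : Set ℂ} : OnePoint.infty ∈ zetaSphere '' K ↔ 1 ∈ K := by
  constructor
  · rintro ⟨s, hs, hinfty⟩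
    by_contra hK
    rw [zetaSphere_of_ne_one (ne_of_mem_of_not_mem hs hK)] at hinfty
    exact OnePoint.coe_ne_infty _ hinfty
  · exact fun hK => ⟨1, hK, zetaSphere_one⟩

theorem theorem5p2_general (c T : ℝ) (φ : ℝ → ℝ) (hφ : Continuous φ)
    (hrange : closure (range φ) = Icc (-T) T) (hzeros : c = 1 → volume {x | φ x = 0} = 0) :
    IsNormal (truncatedSpectralOperator c φ) ∧
    (c ≠ 1 →
      (truncatedSpectralOperator c φ).domain = ⊤ ∧
      IsBounded (truncatedSpectralOperator c φ) ∧
      spectrum (truncatedSpectralOperator c φ) =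
        {z | ∃ τ : ℝ, |τ| ≤ T ∧ z = riemannZeta (c + τ * Complex.I)}) ∧
    (c = 1 →
      ¬ IsBounded (truncatedSpectralOperator c φ) ∧
      extendedSpectrum (truncatedSpectralOperator c φ) =
        {z | ∃ τ : ℝ, |τ| ≤ T ∧ z = zetaSphere (c + τ * Complex.I)}) ∧
    (IsInvertible (truncatedSpectralOperator c φ) ↔
      ∀ s : ℂ, s.re = c → |s.im| ≤ T → zetaSphere s ≠ ((0 : ℂ) : OnePoint ℂ)) := by
  have hT : 0 ≤ T := by
    have hmem : φ 0 ∈ Icc (-T) T := hrange ▸ subset_closure (mem_range_self 0)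
    linarith [hmem.1, hmem.2]
  have hone : (1 : ℂ) ∈ segment c T ↔ c = 1 := by simp [segment, hT, eq_comm]
  have hintegral := isIntegral_truncatedSpectralOperator c hφ.measurable
  have hspec := extendedSpectrum_truncatedSpectralOperator hφ hrange hzeros
  have hbounded : IsBounded (truncatedSpectralOperator c φ) ↔ c ≠ 1 := by
    rw [← not_iff_not, ← infty_mem_extendedSpectrum_iff, hspec, infty_mem_image_zetaSphere_iff,
      hone, not_ne_iff]
  refine ⟨hintegral.isNormal,
    fun hc => ⟨hintegral.domain_eq_top (hbounded.2 hc), hbounded.2 hc, ?_⟩,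
    fun hc => ⟨hbounded.not_left.2 hc, ?_⟩, ?_⟩
  · rw [spectrum_eq_image_of_extendedSpectrum_eq (mt hone.1 hc) hspec, image_segment]
  · rw [hspec, image_segment]
  · rw [isInvertible_iff_zero_notMem_spectrum, ← coe_mem_extendedSpectrum_iff, hspec]
    simp [segment]

end SpectralOperator

open SpectralOperator in
theorem theorem5p2 (c T : ℝ) (hT : 0 < T) (φ : ℝ → ℝ) (hφ : IsAdmissibleCutoff c T φ) :
    IsNormal (truncatedSpectralOperator c φ) ∧
    (c ≠ 1 →
      (truncatedSpectralOperator c φ).domain = ⊤ ∧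
      IsBounded (truncatedSpectralOperator c φ) ∧
      SpectralOperator.spectrum (truncatedSpectralOperator c φ) =
        {z | ∃ τ : ℝ, |τ| ≤ T ∧ z = riemannZeta (c + τ * Complex.I)}) ∧
    (c = 1 →
      ¬ IsBounded (truncatedSpectralOperator c φ) ∧
      extendedSpectrum (truncatedSpectralOperator c φ) =
        {z | ∃ τ : ℝ, |τ| ≤ T ∧ z = zetaSphere (c + τ * Complex.I)}) ∧
    (IsInvertible (truncatedSpectralOperator c φ) ↔
      ∀ s : ℂ, s.re = c → |s.im| ≤ T → zetaSphere s ≠ ((0 : ℂ) : OnePoint ℂ)) :=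
  theorem5p2_general c T φ hφ.1 hφ.2.1 (hφ.volume_zeros hT)
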